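/- **Setting.** Let $M$ be a smooth $n$-manifold that is an $(\overline L_n,g)$-space: it carries a contravariant connection $\nabla_{\partial_k}\partial_j=\Gamma^i_{jk}\partial_i$, an independent covariant connection $\nabla_{\partial_k}dx^i=P^i_{lk}dx^l$, a nondegenerate contraction tensor $S(dx^i,\partial_j)=f^i{}_j$ commuting with $\nabla$ (i.e. $f^i{}_{j,k}=\Gamma^l_{jk}f^i{}_l+P^i_{lk}f^l{}_j$), and a symmetric nondegenerate metric $g_{ij}$, with contravariant metric $g^{ij}$ normalised by $g^{ik}f^j{}_k\,g_{jl}f^l{}_m=\delta^i_m$; all data are smooth. A semicolon is the covariant derivative of components ($\Gamma$ on upper, $P$ on lower indices), $g^i_{j;k}=\Gamma^i_{jk}+P^i_{jk}$ is that of the Kronecker tensor $Kr$, and $(\delta K)^A{}_B=K^{Aj}{}_{B;j}$ is the covariant divergency. Indices of $\partial L/\partial V^A{}_B$ that are dual to those of $V$ are differentiated so that the product rule holds for the contraction with $V$; derivative indices $i,j$ of $\partial L/\partial V^A{}_{B;i}$, $\partial L/\partial V^A{}_{B;i;j}$ are contravariant. Let $V=V^A{}_B$ be a smooth tensor field of arbitrary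 type $(p,q)$, and let $L(f;g_{ij},g_{ij;k},g_{ij;k;l},V^A{}_B,V^A{}_{B;i},V^A{}_{B;i;j})$ be a Lagrangian invariant: smooth on an open set of arguments containing those given by the fields, and invariant under independent linear changes of the contravariant and the covariant bases (upper and lower indices being contracted with each other by means of $f$). For each of the fields $\varphi=V$ and $\varphi=g$ put $$p^i=\frac{\partial L}{\partial\varphi_{;i}},\quad p^{ij}=\frac{\partial L}{\partial\varphi_{;i;j}},\quad \pi^i=p^i-p^{ij}{}_{;j},\quad \frac{\delta L}{\delta\varphi}=\frac{\partial L}{\partial\varphi}-p^i{}_{;i}+p^{ij}{}_{;j;i},$$ let $\rho_i^j$ be the infinitesimal generator acting on covariant indices by $b^l{}_m=\delta^l_i\delta^j_m$ (so $(\rho_i^j\omega)_m=-\delta^j_m\omega_i$) and on contravariant ones by $f^{-1}bf$, and (all contractions over the indices of $\varphi$ understood; $T_{kl}{}^j=\Gamma^j_{lk}-\Gamma^j_{kl}$, $T_k=T_{mk}{}^m$, $R$ and $\widetilde R$ the curvatures of $\Gamma$ and $P$) $$t_i{}^j=\pi^j\varphi_{;i}+p^{kj}\varphi_{;k;i},\qquad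 U_i{}^{jk}=\pi^k\rho_i^j\varphi+p^{lk}\rho_i^j\varphi_{;l}-p^{jk}\varphi_{;i},$$ $$W_i{}^{jk}=\tfrac12(U_i{}^{jk}-U_i{}^{kj}),\qquad K_i{}^j=\tfrac12T_{kl}{}^jW_i{}^{kl},$$ $$N_i{}^j=g^m_{l;k}\,p^{lk}\rho_i^j\varphi_{;m}-g^j_{m;k}\,(\pi^k\rho_i^m\varphi+p^{lk}\rho_i^m\varphi_{;l}),$$ where in $\rho_i^j\varphi_{;l}$ the generator acts only on the indices of $\varphi$. Summing over both fields, define * the generalized canonical energy-momentum tensor $\theta_i{}^j=\sum(t_i{}^j-K_i{}^j-W_i{}^{jk}{}_{;k})-L\delta_i^j$; * the symmetric energy-momentum tensor of Belinfante ${}_sT_i{}^j=\sum\big(\tfrac12(U_i{}^{jk}+U_i{}^{kj})_{;k}+N_i{}^j-K_i{}^j\big)-L\delta_i^j$; * the variational energy-momentum tensor of Euler–Lagrange $Q_i{}^j=\sum\frac{\delta L}{\delta\varphi}\,\rho_i^j\varphi$; * $F={}_vF+{}_gF$ with ${}_vF={}_{va}F+{}_vW$, ${}_gF={}_{ga}F+{}_gW$,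 $({}_{va}F)_k=\frac{\delta_vL}{\delta V^A{}_B}V^A{}_{B;k}$, $({}_{ga}F)_k=\frac{\delta_gL}{\delta g_{ij}}g_{ij;k}$, ${}_aF={}_{va}F+{}_{ga}F$, $W={}_vW+{}_gW$, where ${}_vW$, ${}_gW$ are the respective contributions of $\varphi=V$, $\varphi=g$ to $$\pi^i(\varphi_{;i;k}-\varphi_{;k;i})+p^{ij}(\varphi_{;i;j;k}-\varphi_{;i;k;j})+g^l_{i;j}\,p^{ij}\varphi_{;l;k}+\tfrac12W_k{}^{jl}(R^r{}_{rjl}+T_{l,j}-T_{j,l})+\tfrac12W_r{}^{jl}\widetilde R^r{}_{kjl},$$ and ${}_gW$ contains in addition $L\,g^j_{k;j}$. Here $R^l{}_{ijk}=\Gamma^l_{ik,j}-\Gamma^l_{ij,k}+\Gamma^l_{mj}\Gamma^m_{ik}-\Gamma^l_{mk}\Gamma^m_{ij}$ and $\widetilde R^l{}_{ijk}=P^l_{ik,j}-P^l_{ij,k}+P^m_{ij}P^l_{mk}-P^m_{ik}P^l_{mj}$. **Theorem.** In every chart of $M$ the covariant Noether identities hold: $$F+\delta\theta\equiv0,\qquad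 \theta-{}_sT\equiv Q,\qquad \overline g(F)+\overline g(\delta\theta)\equiv0,\qquad(\theta)\overline g-({}_sT)\overline g\equiv(Q)\overline g,$$ where $\overline g(F)^i=g^{il}f^k{}_lF_k$ and $((G)\overline g)^{ij}=G_k{}^if^k{}_lg^{lj}$. Hence $\delta\theta\equiv\delta{}_sT+\delta Q$ and $\delta{}_sT\equiv\delta\theta-\delta Q$. Moreover: 1. if $\delta\theta=0$, then $F=0$ and $\delta{}_sT=-\delta Q$; 2. if $\delta{}_sT=0$ and $F\ne0$, then $\delta\theta=\delta Q=-F$; if $\delta{}_sT=0$ and $F=0$, then $\delta\theta=\delta Q$; 3. if $\delta Q=0$ and $F\neq0$, then $\delta\theta=\delta{}_sT=-F$; if $\delta Q=0$ and $F=0$, then $\delta\theta=\delta{}_sT=0$; 4. if $\delta_vL/\delta V^A{}_B=0$ and $\delta_gL/\delta g_{ij}=0$, then ${}_{va}F=0$, ${}_{ga}F=0$, $Q=0$, ${}_vF={}_vW$, ${}_gF={}_gW$, ${}_aF=0$, $F=W$, $W+\delta\theta=0$, $\theta={}_sT$ and $\delta\theta=\delta{}_sT=-W$; if in addition $W=0$,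 then $\delta\theta=0$ and $\delta{}_sT=0$. (All equalities are equalities of fields on $M$; $F\neq0$ means that $F$ does not vanish identically.) -/

import Mathlib

open scoped Manifold ContDiff

noncomputable section

namespace LbarGeometry

/-! ### Components of tensors -/

/-- Model space of an `n`-dimensional manifold. -/
abbrev E (n : ℕ) := EuclideanSpace ℝ (Fin n)

/-- Components `K^A_B` of a tensor with `p` contravariant indices `A` and `q` covariant
indices `B`. -/
abbrev Ten (n p q : ℕ) := (Fin p → Fin n) → (Fin q → Fin n) → ℝ

variable {n p q : ℕ}

/-- Partial derivative in the `k`-th coordinate. -/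
def pd (k : Fin n) (F : E n → ℝ) (x : E n) : ℝ := fderiv ℝ F x (EuclideanSpace.single k 1)

/-- Full contraction of components `m_A^B` (dual to a tensor of type `(p, q)`) with `K^A_B`. -/
def pair (m K : Ten n p q) : ℝ := ∑ A, ∑ B, m A B * K A B

/-- `K^A_{B i}` for a fixed value of the last covariant index. -/
def slice (i : Fin n) (K : Ten n p (q + 1)) : Ten n p q := fun A B => K A (Fin.snoc B i)

/-- The components with a single entry `1` at `(A, B)`. -/
def unitTen (A : Fin p → Fin n) (B : Fin q → Fin n) : Ten n p q :=
  Pi.single A (Pi.single B 1)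

/-- The mixed tensor of second rank of type 1 with components `h i j = G_i^j`. -/
def ten11 (h : Fin n → Fin n → ℝ) : Ten n 1 1 := fun A B => h (B 0) (A 0)

/-- The tensor with components `h i j k = W_i^{jk}`. -/
def ten21 (h : Fin n → Fin n → Fin n → ℝ) : Ten n 2 1 := fun A B => h (B 0) (A 0) (A 1)

/-- The covector with components `h i`. -/
def ten01 (h : Fin n → ℝ) : Ten n 0 1 := fun _ B => h (B 0)

/-- The Kronecker tensor. -/
def kronecker (n : ℕ) : Ten n 1 1 := ten11 fun i j => if i = j then 1 else 0

/-- Linear change of the contravariant basis by `A` and of the covariant basis by `B`, with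
`Bi = B⁻¹`: contravariant indices transform with `A`, covariant ones with `B⁻¹`. -/
def act (A Bi : Matrix (Fin n) (Fin n) ℝ) (K : Ten n p q) : Ten n p q := fun C D =>
  ∑ C', ∑ D', (∏ s, A (C s) (C' s)) * (∏ t, Bi (D' t) (D t)) * K C' D'

/-! ### Geometry in one chart -/

/-- The components, in one coordinate chart, of the geometric structure of an
`(L̄_n, g)`-space.
* `Γ x i j k = Γ^i_{jk}`: contravariant connection, `∇_{∂_k} ∂_j = Γ^i_{jk} ∂_i`;
* `P x i l k = P^i_{lk}`: covariant connection, `∇_{∂_k} dx^i = P^i_{lk} dx^l`;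
* `f x i j = f^i_j = S(dx^i, ∂_j)`: contraction tensor;
* `g x`: covariant metric. -/
structure Geo (n : ℕ) where
  Γ : E n → Fin n → Fin n → Fin n → ℝ
  P : E n → Fin n → Fin n → Fin n → ℝ
  f : E n → Fin n → Fin n → ℝ
  g : E n → Ten n 0 2

namespace Geo

variable (G : Geo n)

/-- Covariant derivative `K^A_{B;k}`; the derivative index is the last covariant index.
Contravariant indices are differentiated with `Γ`, covariant ones with `P`. -/
def covD (K : E n → Ten n p q) : E n → Ten n p (q + 1) := fun x A B' =>
  let B : Fin q → Fin n := Fin.init B'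
  let k : Fin n := B' (Fin.last q)
  pd k (fun y => K y A B) x
    + (∑ s, ∑ l, G.Γ x (A s) l k * K x (Function.update A s l) B)
    + ∑ t, ∑ l, G.P x l (B t) k * K x A (Function.update B t l)

/-- Covariant divergency `(δK)^A_B = K^{Aj}_{B;j}`. -/
def covDiv (K : E n → Ten n (p + 1) q) : E n → Ten n p q := fun x A B =>
  ∑ j, G.covD K x (Fin.snoc A j) (Fin.snoc B j)

/-- `φ_{;i}`. -/
def d1 (φ : E n → Ten n p q) (i : Fin n) (x : E n) : Ten n p q := slice i (G.covD φ x)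

/-- `φ_{;i;j}`. -/
def d2 (φ : E n → Ten n p q) (i j : Fin n) (x : E n) : Ten n p q :=
  slice i (slice j (G.covD (G.covD φ) x))

/-- `φ_{;i;j;k}`. -/
def d3 (φ : E n → Ten n p q) (i j k : Fin n) (x : E n) : Ten n p q :=
  slice i (slice j (slice k (G.covD (G.covD (G.covD φ)) x)))

/-- Covariant derivative of the Kronecker tensor, `g^i_{j;k} = Γ^i_{jk} + P^i_{jk}`. -/
def kronD (x : E n) (i j k : Fin n) : ℝ := G.covD (fun _ => kronecker n) x ![i] ![j, k]

/-- Contravariant torsion `T_{kl}^j`, from `T(ξ,u) = ∇_ξ u - ∇_u ξ - [ξ,u]`. -/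
def torsion (x : E n) (k l j : Fin n) : ℝ := G.Γ x j l k - G.Γ x j k l

/-- Torsion covector `T_k = T_{mk}^m`. -/
def torsionTrace (k : Fin n) (x : E n) : ℝ := ∑ m, G.torsion x m k m

/-- Curvature `R^l_{ijk}` of the contravariant connection. -/
def curvΓ (x : E n) (l i j k : Fin n) : ℝ :=
  pd j (fun y => G.Γ y l i k) x - pd k (fun y => G.Γ y l i j) x
    + ∑ m, (G.Γ x l m j * G.Γ x m i k - G.Γ x l m k * G.Γ x m i j)

/-- Curvature `P^l_{ijk}` of the covariant connection. -/
def curvP (x : E n) (l i j k : Fin n) : ℝ :=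
  pd j (fun y => G.P y l i k) x - pd k (fun y => G.P y l i j) x
    + ∑ m, (G.P x m i j * G.P x l m k - G.P x m i k * G.P x l m j)

/-- Contravariant metric `g^{ij}`, the matrix with `(g^{ik} f^j_k) (g_{jl} f^l_m) = δ^i_m`,
i.e. `ḡ(g(u)) = u`. -/
def gUp (x : E n) (i j : Fin n) : ℝ :=
  ((Matrix.of (G.f x))⁻¹ * (Matrix.of fun a b => G.g x ![] ![a, b])⁻¹ *
    ((Matrix.of (G.f x)).transpose)⁻¹) i j

/-- `ḡ(F)`, with components `g^{i k̄} F_k = g^{il} f^k_l F_k`. -/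
def raise1 (F : E n → Ten n 0 1) : E n → Ten n 1 0 := fun x A _ =>
  ∑ k, ∑ l, G.gUp x (A 0) l * G.f x k l * F x ![] ![k]

/-- `(K)ḡ`, with components `K_k^i g^{k̄ j} = K_k^i f^k_l g^{lj}`. -/
def raise2 (K : E n → Ten n 1 1) : E n → Ten n 2 0 := fun x A _ =>
  ∑ k, ∑ l, K x ![A 0] ![k] * G.f x k l * G.gUp x l (A 1)

/-- The infinitesimal linear transformation `(i, j)` of the bases that preserves the contraction
tensor: covariant indices are moved by `b^l_m = δ^l_i δ^j_m`, contravariant ones by `f⁻¹ b f`. -/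
def gen (x : E n) (i j : Fin n) (K : Ten n p q) : Ten n p q := fun A B =>
  (∑ s, ∑ m, (Matrix.of (G.f x))⁻¹ (A s) i * G.f x j m * K (Function.update A s m) B)
    - ∑ t, if B t = j then K A (Function.update B t i) else 0

end Geo

/-! ### Quantities belonging to one field variable -/

/-- Partial derivatives of the Lagrangian invariant with respect to a field `φ^A_B` and its
covariant derivatives, as functions on a chart:
`p0 = ∂L/∂φ^A_B`, `p1 i = ∂L/∂φ^A_{B;i}`, `p2 i j = ∂L/∂φ^A_{B;i;j}`. -/
structure Mom (n p q : ℕ) where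
  p0 : E n → Ten n p q
  p1 : Fin n → E n → Ten n p q
  p2 : Fin n → Fin n → E n → Ten n p q

namespace Geo

variable (G : Geo n)

/-- Derivative along `∂_k` of components `m_A^B` that are dual to those of a field `φ^A_B`,
i.e. the derivative for which `∂_k (m_A^B φ^A_B) = m_A^B{}_{;k} φ^A_B + m_A^B φ^A_{B;k}`.
(As the contraction tensor `f` is covariantly constant, this is the covariant derivative of the
tensor `π` with `m_A^B φ^A_B` equal to the `S`-contraction of `π` and `φ`.) -/
def covDual (k : Fin n) (m : E n → Ten n p q) : E n → Ten n p q := fun x A B =>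
  pd k (fun y => m y A B) x
    - (∑ s, ∑ l, G.Γ x l (A s) k * m x (Function.update A s l) B)
    - ∑ t, ∑ l, G.P x (B t) l k * m x A (Function.update B t l)

/-- Covariant divergency `m_A^{Bi}{}_{;i}`; the index `i` is contravariant. -/
def div1 (m : Fin n → E n → Ten n p q) : E n → Ten n p q := fun x =>
  ∑ i, (G.covDual i (m i) x + ∑ l, G.Γ x i l i • m l x)

/-- Covariant divergency `m_A^{Bij}{}_{;j}`; the indices `i, j` are contravariant. -/
def div2 (m : Fin n → Fin n → E n → Ten n p q) (i : Fin n) : E n → Ten n p q := fun x =>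
  ∑ j, (G.covDual j (m i j) x + (∑ l, G.Γ x i l j • m l j x) + ∑ l, G.Γ x j l j • m i l x)

variable (φ : E n → Ten n p q) (m : Mom n p q)

/-- Covariant variational derivative
`δL/δφ^A_B = ∂L/∂φ^A_B - (∂L/∂φ^A_{B;i})_{;i} + (∂L/∂φ^A_{B;i;j})_{;j;i}`. -/
def eulerLagrange : E n → Ten n p q := fun x =>
  m.p0 x - G.div1 m.p1 x + G.div1 (fun i => G.div2 m.p2 i) x

/-- `π^i = ∂L/∂φ_{;i} - (∂L/∂φ_{;i;j})_{;j}`. -/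
def piMom (i : Fin n) : E n → Ten n p q := fun x => m.p1 i x - G.div2 m.p2 i x

/-- Canonical part `t_i^j = π^j φ_{;i} + (∂L/∂φ_{;k;j}) φ_{;k;i}`. -/
def canon (x : E n) (i j : Fin n) : ℝ :=
  pair (G.piMom m j x) (G.d1 φ i x) + ∑ k, pair (m.p2 k j x) (G.d2 φ k i x)

/-- `U_i^{jk} = π^k (ρ_i^j φ) + (∂L/∂φ_{;l;k}) (ρ_i^j φ_{;l}) - (∂L/∂φ_{;j;k}) φ_{;i}`, where
`ρ_i^j` is the generator `gen`. -/
def spin (x : E n) (i j k : Fin n) : ℝ :=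
  pair (G.piMom m k x) (G.gen x i j (φ x))
    + (∑ l, pair (m.p2 l k x) (G.gen x i j (G.d1 φ l x)))
    - pair (m.p2 j k x) (G.d1 φ i x)

/-- Superpotential `W_i^{jk} = (U_i^{jk} - U_i^{kj}) / 2`. -/
def superpot (x : E n) (i j k : Fin n) : ℝ := (G.spin φ m x i j k - G.spin φ m x i k j) / 2

/-- `(U_i^{jk} + U_i^{kj}) / 2`. -/
def spinSym (x : E n) (i j k : Fin n) : ℝ := (G.spin φ m x i j k + G.spin φ m x i k j) / 2

/-- Torsion term `K_i^j = T_{kl}^j W_i^{kl} / 2`. -/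
def torsK (x : E n) (i j : Fin n) : ℝ :=
  (∑ k, ∑ l, G.torsion x k l j * G.superpot φ m x i k l) / 2

/-- Term built from the covariant derivative of the Kronecker tensor (it vanishes if
`P = -Γ`). -/
def kronTerm (x : E n) (i j : Fin n) : ℝ :=
  (∑ l, ∑ k, ∑ r, G.kronD x r l k * pair (m.p2 l k x) (G.gen x i j (G.d1 φ r x)))
    - ∑ r, ∑ k, G.kronD x j r k * (pair (G.piMom m k x) (G.gen x i r (φ x))
        + ∑ l, pair (m.p2 l k x) (G.gen x i r (G.d1 φ l x)))

/-- Contribution `t_i^j - K_i^j - W_i^{jk}{}_{;k}` of the field to the generalized canonical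
energy-momentum tensor. -/
def thetaPart : E n → Ten n 1 1 := fun x =>
  ten11 (G.canon φ m x) - ten11 (G.torsK φ m x)
    - G.covDiv (fun y => ten21 (G.superpot φ m y)) x

/-- Contribution of the field to the viscosity part `T` of the symmetric energy-momentum tensor of
Belinfante: divergency of the symmetrized `U_i^{jk}`, with torsion and Kronecker terms. -/
def belinfantePart : E n → Ten n 1 1 := fun x =>
  G.covDiv (fun y => ten21 (G.spinSym φ m y)) x + ten11 (G.kronTerm φ m x)
    - ten11 (G.torsK φ m x)

/-- Variational energy-momentum tensor `Q_i^j = (δL/δφ) (ρ_i^j φ)`. -/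
def QPart : E n → Ten n 1 1 := fun x =>
  ten11 fun i j => pair (G.eulerLagrange m x) (G.gen x i j (φ x))

/-- `_aF_k = (δL/δφ) φ_{;k}`. -/
def aFPart : E n → Ten n 0 1 := fun x =>
  ten01 fun k => pair (G.eulerLagrange m x) (G.d1 φ k x)

/-- The covector `W_k`: commutators of covariant derivatives, derivatives of the Kronecker tensor,
and curvature and torsion terms of the superpotential. -/
def WPart : E n → Ten n 0 1 := fun x => ten01 fun k =>
  (∑ i, pair (G.piMom m i x) (G.d2 φ i k x - G.d2 φ k i x))
    + (∑ i, ∑ j, pair (m.p2 i j x) (G.d3 φ i j k x - G.d3 φ i k j x))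
    + (∑ i, ∑ j, ∑ l, G.kronD x l i j * pair (m.p2 i j x) (G.d2 φ l k x))
    + (∑ j, ∑ l, G.superpot φ m x k j l *
        ((∑ r, G.curvΓ x r r j l) + pd j (G.torsionTrace l) x - pd l (G.torsionTrace j) x)) / 2
    + (∑ r, ∑ j, ∑ l, G.superpot φ m x r j l * G.curvP x r k j l) / 2

end Geo

/-! ### Lagrangian invariants -/

/-- Arguments `(f, g, g_{;}, g_{;;}, V, V_{;}, V_{;;})` of a Lagrangian invariant, `V` being of
type `(p, q)`. -/
abbrev Jet (n p q : ℕ) :=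
  (Fin n → Fin n → ℝ) × Ten n 0 2 × Ten n 0 3 × Ten n 0 4 ×
    Ten n p q × Ten n p (q + 1) × Ten n p (q + 2)

/-- Independent linear changes `A` of the contravariant and `B` of the covariant basis. -/
def Jet.act (A B : GL (Fin n) ℝ) (z : Jet n p q) : Jet n p q :=
  let a : Matrix (Fin n) (Fin n) ℝ := A
  let ai : Matrix (Fin n) (Fin n) ℝ := (A⁻¹ : GL (Fin n) ℝ)
  let b : Matrix (Fin n) (Fin n) ℝ := B
  let bi : Matrix (Fin n) (Fin n) ℝ := (B⁻¹ : GL (Fin n) ℝ)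
  (fun i j => (b * Matrix.of z.1 * ai) i j,
    LbarGeometry.act a bi z.2.1, LbarGeometry.act a bi z.2.2.1, LbarGeometry.act a bi z.2.2.2.1,
    LbarGeometry.act a bi z.2.2.2.2.1, LbarGeometry.act a bi z.2.2.2.2.2.1,
    LbarGeometry.act a bi z.2.2.2.2.2.2)

/-- A Lagrangian invariant `L(f; g, g_{;}, g_{;;}, V, V_{;}, V_{;;})`: a smooth function on an open
set of arguments, scalar under changes of the contravariant and covariant bases, contravariant and
covariant indices being contracted with each other by means of `f`. As usual, `L` is a function of
all components `g_{ij}` (for instance extended from symmetric arguments by symmetrization). -/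
structure Lagrangian (n p q : ℕ) where
  dom : Set (Jet n p q)
  isOpen_dom : IsOpen dom
  toFun : Jet n p q → ℝ
  smooth : ContDiffOn ℝ ∞ toFun dom
  invariant : ∀ z ∈ dom, ∀ A B : GL (Fin n) ℝ,
    Jet.act A B z ∈ dom ∧ toFun (Jet.act A B z) = toFun z

/-! ### Fields and geometry on a manifold -/

section Manifold

variable (n) (M : Type*) [TopologicalSpace M]

/-- Coordinate charts. -/
abbrev Chart := OpenPartialHomeomorph M (E n)

/-- A field of components of type `(p, q)` in every coordinate chart. -/
abbrev ChartField (p q : ℕ) := Chart n M → E n → Ten n p q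

variable {n M}

/-- Jacobian matrix `∂x'^i/∂x^a` of the change of coordinates from `e` to `e'`. -/
def jac (e e' : Chart n M) (y : E n) : Matrix (Fin n) (Fin n) ℝ :=
  fun i a => pd a (fun z => e' (e.symm z) i) y

variable [ChartedSpace (E n) M]

/-- Two fields have the same components at every point in every chart of the smooth structure. -/
def SameField (X Y : ChartField n M p q) : Prop :=
  ∀ e ∈ IsManifold.maximalAtlas (𝓡 n) ∞ M, ∀ y ∈ e.target, X e y = Y e y

infix:50 " ≐ " => SameField

/-- Smooth tensor fields: smooth components with the tensorial transformation law. -/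
structure IsTensorField (X : ChartField n M p q) : Prop where
  smooth : ∀ e ∈ IsManifold.maximalAtlas (𝓡 n) ∞ M, ContDiffOn ℝ ∞ (X e) e.target
  transform : ∀ e ∈ IsManifold.maximalAtlas (𝓡 n) ∞ M,
    ∀ e' ∈ IsManifold.maximalAtlas (𝓡 n) ∞ M, ∀ x ∈ e.source ∩ e'.source,
      X e' (e' x) = act (jac e e' (e x)) (jac e' e (e' x)) (X e (e x))

variable (n M) in
/-- A space with contravariant and covariant affine connections and metric: `geo e` are the
components in the chart `e`. The contraction tensor is nondegenerate and commutes with covariant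
differentiation; the metric is symmetric and nondegenerate. -/
structure LbarSpace where
  geo : Chart n M → Geo n
  smoothΓ : ∀ e ∈ IsManifold.maximalAtlas (𝓡 n) ∞ M, ContDiffOn ℝ ∞ (geo e).Γ e.target
  smoothP : ∀ e ∈ IsManifold.maximalAtlas (𝓡 n) ∞ M, ContDiffOn ℝ ∞ (geo e).P e.target
  smoothf : ∀ e ∈ IsManifold.maximalAtlas (𝓡 n) ∞ M, ContDiffOn ℝ ∞ (geo e).f e.target
  transformΓ : ∀ e ∈ IsManifold.maximalAtlas (𝓡 n) ∞ M,
    ∀ e' ∈ IsManifold.maximalAtlas (𝓡 n) ∞ M, ∀ x ∈ e.source ∩ e'.source, ∀ i j k,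
      (geo e').Γ (e' x) i j k = ∑ a, jac e e' (e x) i a *
        ((∑ b, ∑ c, jac e' e (e' x) b j * jac e' e (e' x) c k * (geo e).Γ (e x) a b c)
          + pd k (fun z => jac e' e z a j) (e' x))
  transformP : ∀ e ∈ IsManifold.maximalAtlas (𝓡 n) ∞ M,
    ∀ e' ∈ IsManifold.maximalAtlas (𝓡 n) ∞ M, ∀ x ∈ e.source ∩ e'.source, ∀ i l k,
      (geo e').P (e' x) i l k = ∑ b, ∑ c, jac e' e (e' x) b l * jac e' e (e' x) c k *
        ((∑ a, jac e e' (e x) i a * (geo e).P (e x) a b c)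
          + pd c (fun z => jac e e' z i b) (e x))
  transformf : ∀ e ∈ IsManifold.maximalAtlas (𝓡 n) ∞ M,
    ∀ e' ∈ IsManifold.maximalAtlas (𝓡 n) ∞ M, ∀ x ∈ e.source ∩ e'.source,
      Matrix.of ((geo e').f (e' x))
        = jac e e' (e x) * Matrix.of ((geo e).f (e x)) * jac e' e (e' x)
  metric : IsTensorField (M := M) fun e => (geo e).g
  f_nondeg : ∀ e ∈ IsManifold.maximalAtlas (𝓡 n) ∞ M, ∀ y ∈ e.target,
    IsUnit (Matrix.of ((geo e).f y)).det
  f_parallel : ∀ e ∈ IsManifold.maximalAtlas (𝓡 n) ∞ M, ∀ y ∈ e.target, ∀ i j k,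
    pd k (fun z => (geo e).f z i j) y
      = ∑ l, ((geo e).Γ y l j k * (geo e).f y i l + (geo e).P y i l k * (geo e).f y l j)
  g_symm : ∀ e ∈ IsManifold.maximalAtlas (𝓡 n) ∞ M, ∀ y ∈ e.target, ∀ i j,
    (geo e).g y ![] ![i, j] = (geo e).g y ![] ![j, i]
  g_nondeg : ∀ e ∈ IsManifold.maximalAtlas (𝓡 n) ∞ M, ∀ y ∈ e.target,
    IsUnit (Matrix.of fun i j => (geo e).g y ![] ![i, j]).det

/-- The values in the chart `e` of the arguments of a Lagrangian invariant. -/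
def jetAt (G : Geo n) (V : E n → Ten n p q) (y : E n) : Jet n p q :=
  (G.f y, G.g y, G.covD G.g y, G.covD (G.covD G.g) y, V y, G.covD V y, G.covD (G.covD V) y)

variable (n M) in
/-- A Lagrangian system: an `(L̄_n, g)`-space, a tensor field `V` of type `(p, q)` and a Lagrangian
invariant defined along the fields. -/
structure LagrangianSystem (p q : ℕ) where
  space : LbarSpace n M
  V : ChartField n M p q
  tensorV : IsTensorField V
  L : Lagrangian n p q
  admissible : ∀ e ∈ IsManifold.maximalAtlas (𝓡 n) ∞ M, ∀ y ∈ e.target,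
    jetAt (space.geo e) (V e) y ∈ L.dom

namespace LagrangianSystem

variable (S : LagrangianSystem n M p q)

/-- The Lagrangian invariant as a function on the chart `e`. -/
def Lval (e : Chart n M) (y : E n) : ℝ := S.L.toFun (jetAt (S.space.geo e) (S.V e) y)

/-- Derivative of the Lagrangian invariant in the direction `z`, along the fields. -/
def dL (e : Chart n M) (y : E n) (z : Jet n p q) : ℝ :=
  fderiv ℝ S.L.toFun (jetAt (S.space.geo e) (S.V e) y) z

/-- Partial derivatives with respect to `g`, `g_{;i}`, `g_{;i;j}`. -/
def momG (e : Chart n M) : Mom n 0 2 where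
  p0 y A B := S.dL e y (0, unitTen A B, 0, 0, 0, 0, 0)
  p1 i y A B := S.dL e y (0, 0, unitTen A (Fin.snoc B i), 0, 0, 0, 0)
  p2 i j y A B := S.dL e y (0, 0, 0, unitTen A (Fin.snoc (Fin.snoc B i) j), 0, 0, 0)

/-- Partial derivatives with respect to `V`, `V_{;i}`, `V_{;i;j}`. -/
def momV (e : Chart n M) : Mom n p q where
  p0 y A B := S.dL e y (0, 0, 0, 0, unitTen A B, 0, 0)
  p1 i y A B := S.dL e y (0, 0, 0, 0, 0, unitTen A (Fin.snoc B i), 0)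
  p2 i j y A B := S.dL e y (0, 0, 0, 0, 0, 0, unitTen A (Fin.snoc (Fin.snoc B i) j))

/-- The covariant divergency operator `δ`. -/
def δ {a b : ℕ} (X : ChartField n M (a + 1) b) : ChartField n M a b :=
  fun e => (S.space.geo e).covDiv (X e)

/-- `ḡ(X)` for a covector field `X`. -/
def raise1 (X : ChartField n M 0 1) : ChartField n M 1 0 := fun e => (S.space.geo e).raise1 (X e)

/-- `(X)ḡ` for a mixed tensor field `X`. -/
def raise2 (X : ChartField n M 1 1) : ChartField n M 2 0 := fun e => (S.space.geo e).raise2 (X e)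

/-- `L · Kr`. -/
def LKr : ChartField n M 1 1 := fun e y => S.Lval e y • kronecker n

/-- Variational derivative `δ_v L / δV^A_B`. -/
def ELv (e : Chart n M) : E n → Ten n p q := (S.space.geo e).eulerLagrange (S.momV e)

/-- Variational derivative `δ_g L / δg_{ij}`. -/
def ELg (e : Chart n M) : E n → Ten n 0 2 := (S.space.geo e).eulerLagrange (S.momG e)

/-- Generalized canonical energy-momentum tensor `θ`. -/
def θ : ChartField n M 1 1 := fun e =>
  (S.space.geo e).thetaPart (S.V e) (S.momV e)
    + (S.space.geo e).thetaPart (S.space.geo e).g (S.momG e) - S.LKr e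

/-- Symmetric energy-momentum tensor of Belinfante `_sT`. -/
def sT : ChartField n M 1 1 := fun e =>
  (S.space.geo e).belinfantePart (S.V e) (S.momV e)
    + (S.space.geo e).belinfantePart (S.space.geo e).g (S.momG e) - S.LKr e

/-- Variational energy-momentum tensor of Euler-Lagrange `Q = _vQ + _gQ`. -/
def Q : ChartField n M 1 1 := fun e =>
  (S.space.geo e).QPart (S.V e) (S.momV e)
    + (S.space.geo e).QPart (S.space.geo e).g (S.momG e)

/-- `_{va}F_k = (δ_v L/δV^A_B) V^A_{B;k}`. -/
def vaF : ChartField n M 0 1 := fun e => (S.space.geo e).aFPart (S.V e) (S.momV e)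

/-- `_{ga}F_k = (δ_g L/δg_{ij}) g_{ij;k}`. -/
def gaF : ChartField n M 0 1 := fun e => (S.space.geo e).aFPart (S.space.geo e).g (S.momG e)

/-- `_vW`. -/
def vW : ChartField n M 0 1 := fun e => (S.space.geo e).WPart (S.V e) (S.momV e)

/-- `_gW`; it contains the purely geometric term `L δKr = L g^j_{k;j} dx^k`. -/
def gW : ChartField n M 0 1 := fun e =>
  (S.space.geo e).WPart (S.space.geo e).g (S.momG e)
    + fun y => S.Lval e y • (S.space.geo e).covDiv (p := 0) (fun _ => kronecker n) y

/-- `_aF`. -/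
def aF : ChartField n M 0 1 := S.vaF + S.gaF

/-- `W`. -/
def W : ChartField n M 0 1 := S.vW + S.gW

/-- `_vF`. -/
def vF : ChartField n M 0 1 := S.vaF + S.vW

/-- `_gF`. -/
def gF : ChartField n M 0 1 := S.gaF + S.gW

/-- `F = _vF + _gF`. -/
def F : ChartField n M 0 1 := S.vF + S.gF

/-- Local covariant conserved quantities: `δX = 0`. -/
def Conserved (X : ChartField n M 1 1) : Prop := S.δ (a := 0) X ≐ 0

end LagrangianSystem

end Manifold

end LbarGeometry

end

open LbarGeometry

open LbarGeometry

noncomputable section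

namespace LbarGeometry

open Function

variable {n p q : ℕ}

/-! ### Partial derivatives -/

/-! Everything rests on the representation `infAct` of the Lie algebra gl(n) × gl(n): `a` acts on
contravariant indices and `-b` on covariant ones. In these terms the covariant derivative along
`∂_k` is the partial derivative plus the action of the pair (Γ_k, -P_k). The contraction `pair`
intertwines this action with its transpose, which gives the product rule.

Invariance of the Lagrangian says that its derivative vanishes along the infinitesimal action of
every pair `(a, b)` on the jet (`Lagrangian.fderiv_infAct`). Two choices of the pair are used, and
in both the argument `f` drops out. The pair (f⁻¹ e f, e), with `e` an elementary matrix, fixes `f`;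
the changes contributed by `V` and `g` under the generator therefore add up to zero
(`genChange_add_genChange`). The pair (-Γ_k, P_k) reproduces `∂_k f`, because `f` is parallel; what
remains of `∂_k` of the jet consists of covariant derivatives, so `∂_k L` is the sum of the changes
of the two fields (`pd_Lval`).

The rest is integration by parts for a single field of arbitrary type with arbitrary smooth momenta,
where no Lagrangian enters. One computation (`thetaPart_sub_belinfantePart`) expresses θ - sT as Q
minus the change under the generator; the other (`aFPart_add_WPart_add_covDiv_thetaPart`) expresses
F + δθ, without the `L` terms, as the change along `∂_k`. The Kronecker terms arise because an upper
index is differentiated with Γ and a lower one with P, so that contracted indices leave Γ + P behind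
(`d1_gen`, `div21_spin`, `div11_canon`). The curvature and torsion terms are the double divergency
of the antisymmetric superpotential, in which all derivatives of the superpotential cancel
(`div11_superpot`).

Adding the contributions of `V` and `g` and inserting the two consequences of invariance gives the
Noether identities. The remaining claims are linear algebra on these. -/

theorem pd_const (k : Fin n) (c : ℝ) (x : E n) : pd k (fun _ => c) x = 0 := by
  simp [pd]

theorem pd_add {k : Fin n} {F H : E n → ℝ} {x : E n} (hF : DifferentiableAt ℝ F x)
    (hH : DifferentiableAt ℝ H x) : pd k (fun y => F y + H y) x = pd k F x + pd k H x := by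
  simp [pd, fderiv_fun_add hF hH]

theorem pd_sub {k : Fin n} {F H : E n → ℝ} {x : E n} (hF : DifferentiableAt ℝ F x)
    (hH : DifferentiableAt ℝ H x) : pd k (fun y => F y - H y) x = pd k F x - pd k H x := by
  simp [pd, fderiv_fun_sub hF hH]

theorem pd_neg {k : Fin n} {F : E n → ℝ} {x : E n} : pd k (fun y => - F y) x = - pd k F x := by
  simp [pd]

theorem pd_mul {k : Fin n} {F H : E n → ℝ} {x : E n} (hF : DifferentiableAt ℝ F x)
    (hH : DifferentiableAt ℝ H x) :
    pd k (fun y => F y * H y) x = pd k F x * H x + F x * pd k H x := by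
  simp [pd, fderiv_fun_mul hF hH]; ring

theorem pd_sum {ι : Type*} {k : Fin n} {u : Finset ι} {F : ι → E n → ℝ} {x : E n}
    (hF : ∀ i ∈ u, DifferentiableAt ℝ (F i) x) :
    pd k (fun y => ∑ i ∈ u, F i y) x = ∑ i ∈ u, pd k (F i) x := by
  simp [pd, fderiv_fun_sum hF]

theorem pd_congr {k : Fin n} {F H : E n → ℝ} {U : Set (E n)} (hU : IsOpen U)
    (h : ∀ y ∈ U, F y = H y) {x : E n} (hx : x ∈ U) : pd k F x = pd k H x := by
  have : F =ᶠ[nhds x] H := by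
    filter_upwards [hU.mem_nhds hx] with y hy using h y hy
  simp [pd, this.fderiv_eq]

theorem contDiffOn_pd {U : Set (E n)} (hU : IsOpen U) {F : E n → ℝ} (hF : ContDiffOn ℝ ∞ F U)
    (k : Fin n) : ContDiffOn ℝ ∞ (pd k F) U :=
  (hF.fderiv_of_isOpen hU (m := ∞) (by simp)).clm_apply contDiffOn_const

theorem pd_comm {U : Set (E n)} (hU : IsOpen U) {F : E n → ℝ} (hF : ContDiffOn ℝ ∞ F U)
    {x : E n} (hx : x ∈ U) (j k : Fin n) : pd j (pd k F) x = pd k (pd j F) x := by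
  have h1 : ContDiffAt ℝ ∞ F x := hF.contDiffAt (hU.mem_nhds hx)
  have h2 : IsSymmSndFDerivAt ℝ F x :=
    h1.isSymmSndFDerivAt (by simpa using (WithTop.coe_le_coe.2 (le_top : (2 : ℕ∞) ≤ ⊤)))
  have h3 : DifferentiableAt ℝ (fderiv ℝ F) x :=
    (((hF.fderiv_of_isOpen hU (m := ∞) (by simp)).contDiffAt
      (hU.mem_nhds hx)).differentiableAt (by simp))
  have key : ∀ a b : Fin n, pd a (pd b F) x
      = fderiv ℝ (fderiv ℝ F) x (EuclideanSpace.single a 1) (EuclideanSpace.single b 1) := by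
    intro a b
    unfold pd
    rw [fderiv_clm_apply h3 (differentiableAt_const _)]
    simp
  rw [key, key, h2]

/-! ### Derivations acting on multi-indices -/

/-- Sum over the slots `s` of the matrix `a` acting on the `s`-th index. -/
def slotAct {r : ℕ} (a : Matrix (Fin n) (Fin n) ℝ) (κ : (Fin r → Fin n) → ℝ) :
    (Fin r → Fin n) → ℝ := fun A => ∑ s, ∑ l, a (A s) l * κ (update A s l)

/-- Exchanging the `s`-th entry of `A` with `l` is an involution on the pairs `(A, l)`. -/
theorem sum_update_swap {r : ℕ} (s : Fin r) (h : (Fin r → Fin n) → (Fin r → Fin n) → ℝ) :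
    ∑ A, ∑ l, h A (update A s l) = ∑ A, ∑ l, h (update A s l) A := by
  rw [← Finset.sum_product', ← Finset.sum_product']
  refine Finset.sum_nbij' (fun z => (update z.1 s z.2, z.1 s)) (fun z => (update z.1 s z.2, z.1 s))
    ?_ ?_ ?_ ?_ ?_ <;> simp

/-- In each slot, `sum_update_swap` exchanges the removed index with the inserted one, which moves
the matrix to the other factor and transposes it. -/
theorem sum_slotAct_transpose {r : ℕ} (a : Matrix (Fin n) (Fin n) ℝ)
    (μ κ : (Fin r → Fin n) → ℝ) :
    ∑ A, slotAct a.transpose μ A * κ A = ∑ A, μ A * slotAct a κ A := by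
  simp only [slotAct, Finset.sum_mul, Finset.mul_sum, Matrix.transpose_apply]
  rw [Finset.sum_comm, Finset.sum_comm (s := Finset.univ (α := Fin r → Fin n))]
  refine Finset.sum_congr rfl fun s _ => ?_
  have := sum_update_swap s fun A A' : Fin r → Fin n => a (A' s) (A s) * μ A' * κ A
  simp only [update_self] at this
  rw [this]
  refine Finset.sum_congr rfl fun A _ => Finset.sum_congr rfl fun l _ => by ring

/-- Two successive slots either coincide, where the matrices multiply, or differ. The second kind is
kept as an explicit double sum because it is symmetric in the two matrices and so disappears from
commutators. -/
theorem slotAct_slotAct {r : ℕ} (a a' : Matrix (Fin n) (Fin n) ℝ) (κ : (Fin r → Fin n) → ℝ)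
    (A : Fin r → Fin n) :
    slotAct a (slotAct a' κ) A = slotAct (a * a') κ A
      + ∑ s, ∑ s', if s' = s then 0 else
          ∑ l, ∑ l', a (A s) l * a' (A s') l' * κ (update (update A s l) s' l') := by
  simp only [slotAct]
  rw [← Finset.sum_add_distrib]
  refine Finset.sum_congr rfl fun s _ => ?_
  have h1 : ∀ l, ∑ s', ∑ l', a' (update A s l s') l' * κ (update (update A s l) s' l')
      = (∑ l', a' l l' * κ (update A s l')) + ∑ s', if s' = s then 0 else
        ∑ l', a' (A s') l' * κ (update (update A s l) s' l') := by
    intro l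
    rw [← Finset.add_sum_erase _ _ (Finset.mem_univ s)]
    congr 1
    · simp
    · rw [← Finset.add_sum_erase Finset.univ (fun s' => if s' = s then (0:ℝ) else _)
        (Finset.mem_univ s), if_pos rfl, zero_add]
      refine Finset.sum_congr rfl fun s' hs' => ?_
      have : s' ≠ s := Finset.ne_of_mem_erase hs'
      simp [this]
  simp only [h1, mul_add, Finset.sum_add_distrib]
  congr 1
  · simp only [Matrix.mul_apply, Finset.mul_sum, Finset.sum_mul]
    rw [Finset.sum_comm]
    simp only [mul_assoc]
  · simp only [Finset.mul_sum]
    rw [Finset.sum_comm]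
    refine Finset.sum_congr rfl fun s' _ => ?_
    split_ifs
    · simp
    · simp [Finset.mul_sum, mul_assoc]

theorem slotAct_commutator {r : ℕ} (a a' : Matrix (Fin n) (Fin n) ℝ) (κ : (Fin r → Fin n) → ℝ)
    (A : Fin r → Fin n) :
    slotAct a (slotAct a' κ) A - slotAct a' (slotAct a κ) A
      = slotAct (a * a' - a' * a) κ A := by
  have h : (∑ s, ∑ s', if s' = s then 0 else
        ∑ l, ∑ l', a (A s) l * a' (A s') l' * κ (update (update A s l) s' l'))
      = ∑ s, ∑ s', if s' = s then 0 else
        ∑ l, ∑ l', a' (A s) l * a (A s') l' * κ (update (update A s l) s' l') := by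
    rw [Finset.sum_comm]
    refine Finset.sum_congr rfl fun s _ => Finset.sum_congr rfl fun s' _ => ?_
    by_cases hs : s = s'
    · simp [hs]
    · rw [if_neg hs, if_neg (Ne.symm hs), Finset.sum_comm]
      refine Finset.sum_congr rfl fun l _ => Finset.sum_congr rfl fun l' _ => ?_
      rw [update_comm (Ne.symm hs)]; ring
  rw [slotAct_slotAct, slotAct_slotAct, h]
  simp [slotAct, sub_mul, Finset.sum_sub_distrib]

/-- Infinitesimal change of the bases: `a` acts on contravariant, `-b` on covariant indices. -/
def infAct (a b : Matrix (Fin n) (Fin n) ℝ) (K : Ten n p q) : Ten n p q := fun A B =>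
  slotAct a (fun A' => K A' B) A - slotAct b.transpose (K A) B

theorem infAct_add (a b : Matrix (Fin n) (Fin n) ℝ) (K K' : Ten n p q) :
    infAct a b (K + K') = infAct a b K + infAct a b K' := by
  ext A B; simp [infAct, slotAct, mul_add, Finset.sum_add_distrib]; ring

theorem infAct_smul (a b : Matrix (Fin n) (Fin n) ℝ) (c : ℝ) (K : Ten n p q) :
    infAct a b (c • K) = c • infAct a b K := by
  ext A B; simp [infAct, slotAct, Finset.mul_sum, mul_sub, mul_left_comm]

/-- `infAct` as a linear map. -/
def infActL (a b : Matrix (Fin n) (Fin n) ℝ) : Ten n p q →ₗ[ℝ] Ten n p q where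
  toFun := infAct a b
  map_add' := infAct_add a b
  map_smul' := infAct_smul a b

theorem infAct_sub (a b : Matrix (Fin n) (Fin n) ℝ) (K K' : Ten n p q) :
    infAct a b (K - K') = infAct a b K - infAct a b K' := map_sub (infActL a b) K K'

theorem infAct_sum {ι : Type*} (a b : Matrix (Fin n) (Fin n) ℝ) (u : Finset ι)
    (K : ι → Ten n p q) : infAct a b (∑ i ∈ u, K i) = ∑ i ∈ u, infAct a b (K i) :=
  map_sum (infActL a b) K u

theorem infAct_add_left (a b a' b' : Matrix (Fin n) (Fin n) ℝ) (K : Ten n p q) :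
    infAct (a + a') (b + b') K = infAct a b K + infAct a' b' K := by
  ext A B; simp [infAct, slotAct, add_mul, Finset.sum_add_distrib]; ring

theorem infAct_smul_left (c : ℝ) (a b : Matrix (Fin n) (Fin n) ℝ) (K : Ten n p q) :
    infAct (c • a) (c • b) K = c • infAct a b K := by
  ext A B; simp [infAct, slotAct, Finset.mul_sum, mul_sub, mul_assoc]

theorem infAct_zero_left (K : Ten n p q) : infAct 0 0 K = 0 := by
  ext A B; simp [infAct, slotAct]

theorem infAct_sum_left {ι : Type*} (u : Finset ι) (a b : ι → Matrix (Fin n) (Fin n) ℝ)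
    (K : Ten n p q) :
    infAct (∑ i ∈ u, a i) (∑ i ∈ u, b i) K = ∑ i ∈ u, infAct (a i) (b i) K := by
  classical
  induction u using Finset.induction_on with
  | empty => simp [infAct_zero_left]
  | insert i u hi ih => rw [Finset.sum_insert hi, Finset.sum_insert hi, infAct_add_left, ih,
      Finset.sum_insert hi]

theorem infAct_neg_left (a b : Matrix (Fin n) (Fin n) ℝ) (K : Ten n p q) :
    infAct (-a) (-b) K = - infAct a b K := by
  have := infAct_smul_left (-1) a b K
  simpa using this

/-- On lower indices the transpose reverses products and the minus sign restores their order, so the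
Lie bracket is preserved on both kinds of indices. -/
theorem infAct_commutator (a b a' b' : Matrix (Fin n) (Fin n) ℝ) (K : Ten n p q) :
    infAct a b (infAct a' b' K) - infAct a' b' (infAct a b K)
      = infAct (a * a' - a' * a) (b * b' - b' * b) K := by
  ext A B
  have hA := slotAct_commutator a a' (fun A' => K A' B) A
  have hB := slotAct_commutator b.transpose b'.transpose (K A) B
  -- Actions on upper and on lower slots commute, so the mixed terms cancel in the commutator.
  have cross : ∀ c d : Matrix (Fin n) (Fin n) ℝ,
      slotAct c (fun A' => slotAct d (K A') B) A
        = slotAct d (fun B' => slotAct c (fun A' => K A' B') A) B := by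
    intro c d
    simp only [slotAct, Finset.mul_sum]
    have h1 : ∀ s : Fin p, ∑ l, ∑ t : Fin q, ∑ m,
          c (A s) l * (d (B t) m * K (update A s l) (update B t m))
        = ∑ t : Fin q, ∑ m, ∑ l, d (B t) m * (c (A s) l * K (update A s l) (update B t m)) := by
      intro s
      rw [Finset.sum_comm]
      refine Finset.sum_congr rfl fun t _ => ?_
      rw [Finset.sum_comm]
      exact Finset.sum_congr rfl fun m _ => Finset.sum_congr rfl fun l _ => by ring
    simp only [h1]
    rw [Finset.sum_comm]
    exact Finset.sum_congr rfl fun t _ => Finset.sum_comm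
  have sub1 : ∀ c d e : Matrix (Fin n) (Fin n) ℝ,
      slotAct c (fun A' => infAct d e K A' B) A
        = slotAct c (slotAct d fun A' => K A' B) A
          - slotAct c (fun A' => slotAct e.transpose (K A') B) A := by
    intro c d e
    simp [infAct, slotAct, mul_sub, Finset.sum_sub_distrib]
  have sub2 : ∀ c d e : Matrix (Fin n) (Fin n) ℝ,
      slotAct c.transpose (infAct d e K A) B
        = slotAct c.transpose (fun B' => slotAct d (fun A' => K A' B') A) B
          - slotAct c.transpose (slotAct e.transpose (K A)) B := by
    intro c d e
    simp [infAct, slotAct, mul_sub, Finset.sum_sub_distrib]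
  have e1 : ∀ (c d : Matrix (Fin n) (Fin n) ℝ) (J : Ten n p q), infAct c d J A B
      = slotAct c (fun A' => J A' B) A - slotAct d.transpose (J A) B := fun _ _ _ => rfl
  simp only [Pi.sub_apply]
  rw [e1 a b, e1 a' b', e1 (_ - _) (_ - _), sub1, sub1, sub2, sub2, cross a, cross a', ← hA]
  have : (b * b' - b' * b).transpose = -(b.transpose * b'.transpose
      - b'.transpose * b.transpose) := by
    simp [Matrix.transpose_sub, Matrix.transpose_mul]
  have h3 : slotAct (b * b' - b' * b).transpose (K A) B
      = - slotAct (b.transpose * b'.transpose - b'.transpose * b.transpose) (K A) B := by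
    rw [this]; simp only [slotAct, Matrix.neg_apply, neg_mul, Finset.sum_neg_distrib]
  rw [h3, ← hB]; ring

/-! ### Contraction -/

theorem pair_add_left (m m' K : Ten n p q) : pair (m + m') K = pair m K + pair m' K := by
  simp [pair, add_mul, Finset.sum_add_distrib]

theorem pair_add_right (m K K' : Ten n p q) : pair m (K + K') = pair m K + pair m K' := by
  simp [pair, mul_add, Finset.sum_add_distrib]

theorem pair_smul_left (c : ℝ) (m K : Ten n p q) : pair (c • m) K = c * pair m K := by
  simp [pair, Finset.mul_sum, mul_assoc]

theorem pair_smul_right (c : ℝ) (m K : Ten n p q) : pair m (c • K) = c * pair m K := by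
  simp [pair, Finset.mul_sum, mul_left_comm]

/-- `pair` as a bilinear map. -/
def pairL : Ten n p q →ₗ[ℝ] Ten n p q →ₗ[ℝ] ℝ :=
  LinearMap.mk₂ ℝ pair pair_add_left pair_smul_left pair_add_right
    (fun c m K => pair_smul_right c m K)

theorem pair_sub_left (m m' K : Ten n p q) : pair (m - m') K = pair m K - pair m' K :=
  LinearMap.map_sub₂ pairL m m' K

theorem pair_sub_right (m K K' : Ten n p q) : pair m (K - K') = pair m K - pair m K' :=
  map_sub (pairL m) K K'

theorem pair_zero_left (K : Ten n p q) : pair 0 K = 0 := LinearMap.map_zero₂ pairL K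

theorem pair_sum_left {ι : Type*} (u : Finset ι) (m : ι → Ten n p q) (K : Ten n p q) :
    pair (∑ i ∈ u, m i) K = ∑ i ∈ u, pair (m i) K :=
  LinearMap.map_sum₂ pairL u m K

theorem pair_sum_right {ι : Type*} (u : Finset ι) (m : Ten n p q) (K : ι → Ten n p q) :
    pair m (∑ i ∈ u, K i) = ∑ i ∈ u, pair m (K i) := map_sum (pairL m) K u

/-- Invariance of the contraction. It makes the connection terms cancel in the product rule when the
dual components are differentiated with the transposed connection. -/
theorem pair_infAct (a b : Matrix (Fin n) (Fin n) ℝ) (m K : Ten n p q) :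
    pair (infAct a.transpose b.transpose m) K = pair m (infAct a b K) := by
  simp only [pair, infAct, sub_mul, mul_sub, Finset.sum_sub_distrib]
  congr 1
  · rw [Finset.sum_comm]
    rw [Finset.sum_comm (f := fun A B => m A B * _)]
    exact Finset.sum_congr rfl fun B _ => sum_slotAct_transpose a (fun A => m A B) fun A => K A B
  · exact Finset.sum_congr rfl fun A _ => sum_slotAct_transpose b.transpose (m A) (K A)

/-! ### Covariant derivatives in terms of infinitesimal changes of bases -/

/-- Componentwise partial derivative. -/
def pdT (k : Fin n) (K : E n → Ten n p q) (x : E n) : Ten n p q :=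
  fun A B => pd k (fun y => K y A B) x

theorem Ten.differentiableAt {K : E n → Ten n p q} {x : E n} (hK : DifferentiableAt ℝ K x)
    (A : Fin p → Fin n) (B : Fin q → Fin n) : DifferentiableAt ℝ (fun y => K y A B) x :=
  differentiableAt_pi.1 (differentiableAt_pi.1 hK A) B

theorem pdT_add {k : Fin n} {K K' : E n → Ten n p q} {x : E n} (hK : DifferentiableAt ℝ K x)
    (hK' : DifferentiableAt ℝ K' x) :
    pdT k (fun y => K y + K' y) x = pdT k K x + pdT k K' x := by
  ext A B
  exact pd_add (Ten.differentiableAt hK A B) (Ten.differentiableAt hK' A B)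

theorem pdT_smul {k : Fin n} {c : E n → ℝ} {K : E n → Ten n p q} {x : E n}
    (hc : DifferentiableAt ℝ c x) (hK : DifferentiableAt ℝ K x) :
    pdT k (fun y => c y • K y) x = pd k c x • K x + c x • pdT k K x := by
  ext A B
  exact pd_mul hc (Ten.differentiableAt hK A B)

theorem pd_pair {k : Fin n} {m K : E n → Ten n p q} {x : E n} (hm : DifferentiableAt ℝ m x)
    (hK : DifferentiableAt ℝ K x) :
    pd k (fun y => pair (m y) (K y)) x = pair (pdT k m x) (K x) + pair (m x) (pdT k K x) := by
  have h : ∀ A B, DifferentiableAt ℝ (fun y => m y A B * K y A B) x := fun A B =>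
    (Ten.differentiableAt hm A B).mul (Ten.differentiableAt hK A B)
  simp only [pair]
  rw [pd_sum fun A _ => DifferentiableAt.fun_sum fun B _ => h A B, ← Finset.sum_add_distrib]
  refine Finset.sum_congr rfl fun A _ => ?_
  rw [pd_sum fun B _ => h A B, ← Finset.sum_add_distrib]
  exact Finset.sum_congr rfl fun B _ =>
    pd_mul (Ten.differentiableAt hm A B) (Ten.differentiableAt hK A B)

theorem slice_add (i : Fin n) (K K' : Ten n p (q + 1)) :
    slice i (K + K') = slice i K + slice i K' := rfl

/-- The frozen last index is itself covariant and is moved by `b` too. The correction yields the P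
terms on derivative indices in `d2_eq` and `d3_eq`, and the negative terms of `genChange`. -/
theorem slice_infAct (i : Fin n) (a b : Matrix (Fin n) (Fin n) ℝ) (K : Ten n p (q + 1)) :
    slice i (infAct a b K) = infAct a b (slice i K) - ∑ l, b l i • slice l K := by
  ext A B
  simp only [slice, infAct, slotAct, Fin.sum_univ_castSucc (n := q), Fin.snoc_castSucc,
    Fin.snoc_last, ← Fin.snoc_update, Fin.update_snoc_last, Matrix.transpose_apply, Pi.sub_apply,
    Finset.sum_apply, Pi.smul_apply, smul_eq_mul]
  ring

namespace Geo

variable (G : Geo n)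

/-- The contravariant connection in the direction `∂_k`. -/
def Γm (k : Fin n) (x : E n) : Matrix (Fin n) (Fin n) ℝ := Matrix.of fun i j => G.Γ x i j k

/-- The covariant connection in the direction `∂_k`. -/
def Pm (k : Fin n) (x : E n) : Matrix (Fin n) (Fin n) ℝ := Matrix.of fun i l => G.P x i l k

/-- The sign in `-G.Pm` compensates the one that `infAct` puts on covariant indices. -/
theorem covD_snoc (K : E n → Ten n p q) (x : E n) (k : Fin n) :
    slice k (G.covD K x) = pdT k K x + infAct (G.Γm k x) (-G.Pm k x) (K x) := by
  ext A B
  simp [slice, covD, infAct, slotAct, Γm, Pm, pdT, Fin.init_snoc]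
  ring

theorem d1_eq (K : E n → Ten n p q) (x : E n) (k : Fin n) :
    G.d1 K k x = pdT k K x + infAct (G.Γm k x) (-G.Pm k x) (K x) := G.covD_snoc K x k

theorem covDual_eq (k : Fin n) (m : E n → Ten n p q) (x : E n) :
    G.covDual k m x
      = pdT k m x - infAct (G.Γm k x).transpose (-G.Pm k x).transpose (m x) := by
  ext A B
  simp [covDual, infAct, slotAct, Γm, Pm, pdT]
  ring

theorem pd_pair_covDual {k : Fin n} {m K : E n → Ten n p q} {x : E n}
    (hm : DifferentiableAt ℝ m x) (hK : DifferentiableAt ℝ K x) :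
    pd k (fun y => pair (m y) (K y)) x
      = pair (G.covDual k m x) (K x) + pair (m x) (G.d1 K k x) := by
  rw [pd_pair hm hK, covDual_eq, d1_eq, pair_sub_left, pair_add_right, pair_infAct]; ring

theorem slice_pdT (i k : Fin n) (K : E n → Ten n p (q + 1)) (x : E n) :
    slice i (pdT k K x) = pdT k (fun y => slice i (K y)) x := rfl

theorem slice_d1 (i j : Fin n) (K : E n → Ten n p (q + 1)) (x : E n) :
    slice i (G.d1 K j x)
      = G.d1 (fun y => slice i (K y)) j x + ∑ l, G.P x l i j • slice l (K x) := by
  rw [d1_eq, d1_eq, slice_add, slice_pdT, slice_infAct]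
  simp [Pm, add_assoc, sub_eq_add_neg]

/-- On the right `i` is a mere label for the outer derivative; the P term accounts for its being a
covariant index. -/
theorem d2_eq (φ : E n → Ten n p q) (i j : Fin n) (x : E n) :
    G.d2 φ i j x = G.d1 (G.d1 φ i) j x + ∑ l, G.P x l i j • G.d1 φ l x :=
  G.slice_d1 i j (G.covD φ) x

theorem d3_eq (φ : E n → Ten n p q) (i j k : Fin n) (x : E n) :
    G.d3 φ i j k x = G.d1 (G.d2 φ i j) k x + (∑ l, G.P x l i k • G.d2 φ l j x)
      + ∑ l, G.P x l j k • G.d2 φ i l x := by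
  have h : G.d3 φ i j k x = slice i (slice j (G.d1 (G.covD (G.covD φ)) k x)) := rfl
  rw [h, slice_d1, slice_add, slice_d1]
  have h2 : slice i (∑ l, G.P x l j k • slice l (G.covD (G.covD φ) x))
      = ∑ l, G.P x l j k • G.d2 φ i l x := by
    ext A B; simp [slice, d2]
  rw [h2]; rfl

theorem kronD_eq (x : E n) (i j k : Fin n) : G.kronD x i j k = G.Γ x i j k + G.P x i j k := by
  simp [kronD, covD, kronecker, ten11, pd_const, Fin.init]

theorem covDiv_ten11 (h : E n → Fin n → Fin n → ℝ) (x : E n) (A : Fin 0 → Fin n)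
    (B : Fin 1 → Fin n) :
    G.covDiv (p := 0) (fun y => ten11 (h y)) x A B
      = ∑ j, (pd j (fun y => h y (B 0) j) x + (∑ l, G.Γ x j l j * h x (B 0) l)
        + ∑ l, G.P x l (B 0) j * h x l j) := by
  simp only [covDiv, covD, ten11, Fin.init_snoc, Fin.snoc_last]
  refine Finset.sum_congr rfl fun j _ => ?_
  simp [Fin.snoc]

theorem covDiv_ten21 (h : E n → Fin n → Fin n → Fin n → ℝ) (x : E n) (A : Fin 1 → Fin n)
    (B : Fin 1 → Fin n) :
    G.covDiv (p := 1) (fun y => ten21 (h y)) x A B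
      = ∑ k, (pd k (fun y => h y (B 0) (A 0) k) x
        + (∑ l, G.Γ x (A 0) l k * h x (B 0) l k) + (∑ l, G.Γ x k l k * h x (B 0) (A 0) l)
        + ∑ l, G.P x l (B 0) k * h x l (A 0) k) := by
  simp only [covDiv, covD, ten21, Fin.init_snoc, Fin.snoc_last]
  refine Finset.sum_congr rfl fun j _ => ?_
  simp [Fin.snoc, Fin.sum_univ_two, add_assoc]

end Geo

/-! ### Smoothness -/

theorem contDiffOn_ten {U : Set (E n)} {K : E n → Ten n p q} :
    ContDiffOn ℝ ∞ K U ↔ ∀ A B, ContDiffOn ℝ ∞ (fun y => K y A B) U := by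
  rw [contDiffOn_pi]
  exact forall_congr' fun A => contDiffOn_pi

theorem contDiffOn_pdT {U : Set (E n)} (hU : IsOpen U) {K : E n → Ten n p q}
    (hK : ContDiffOn ℝ ∞ K U) (k : Fin n) : ContDiffOn ℝ ∞ (pdT k K) U :=
  contDiffOn_ten.2 fun A B => contDiffOn_pd hU (contDiffOn_ten.1 hK A B) k

theorem contDiffOn_pair {U : Set (E n)} {m K : E n → Ten n p q}
    (hm : ContDiffOn ℝ ∞ m U) (hK : ContDiffOn ℝ ∞ K U) :
    ContDiffOn ℝ ∞ (fun y => pair (m y) (K y)) U :=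
  ContDiffOn.sum fun A _ => ContDiffOn.sum fun B _ =>
    (contDiffOn_ten.1 hm A B).mul (contDiffOn_ten.1 hK A B)

theorem contDiffOn_infAct {U : Set (E n)} {a b : E n → Matrix (Fin n) (Fin n) ℝ}
    {K : E n → Ten n p q} (ha : ∀ i j, ContDiffOn ℝ ∞ (fun y => a y i j) U)
    (hb : ∀ i j, ContDiffOn ℝ ∞ (fun y => b y i j) U) (hK : ContDiffOn ℝ ∞ K U) :
    ContDiffOn ℝ ∞ (fun y => infAct (a y) (b y) (K y)) U :=
  contDiffOn_ten.2 fun _ _ =>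
    (ContDiffOn.sum fun _ _ => ContDiffOn.sum fun _ _ =>
      (ha _ _).mul (contDiffOn_ten.1 hK _ _)).sub
    (ContDiffOn.sum fun _ _ => ContDiffOn.sum fun _ _ =>
      (hb _ _).mul (contDiffOn_ten.1 hK _ _))

theorem contDiffOn_slice {U : Set (E n)} {K : E n → Ten n p (q + 1)} (i : Fin n)
    (hK : ContDiffOn ℝ ∞ K U) : ContDiffOn ℝ ∞ (fun y => slice i (K y)) U :=
  contDiffOn_ten.2 fun A B => contDiffOn_ten.1 hK A (Fin.snoc B i)

theorem contDiffOn_det {U : Set (E n)} {r : ℕ} {a : E n → Matrix (Fin r) (Fin r) ℝ}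
    (ha : ∀ i j, ContDiffOn ℝ ∞ (fun y => a y i j) U) :
    ContDiffOn ℝ ∞ (fun y => (a y).det) U := by
  simp only [Matrix.det_apply]
  exact ContDiffOn.sum fun σ _ => (contDiffOn_prod fun i _ => ha _ _).const_smul _

/-- Cramer's rule: an entry of the inverse is a cofactor divided by the nonvanishing determinant. -/
theorem contDiffOn_inv {U : Set (E n)} {r : ℕ} {a : E n → Matrix (Fin r) (Fin r) ℝ}
    (ha : ∀ i j, ContDiffOn ℝ ∞ (fun y => a y i j) U) (hdet : ∀ y ∈ U, (a y).det ≠ 0)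
    (i j : Fin r) : ContDiffOn ℝ ∞ (fun y => (a y)⁻¹ i j) U := by
  simp only [Matrix.inv_def, Matrix.smul_apply, Ring.inverse_eq_inv', smul_eq_mul,
    Matrix.adjugate_apply]
  refine ((contDiffOn_det ha).inv hdet).mul (contDiffOn_det fun k l => ?_)
  simp only [Matrix.updateRow_apply]
  split_ifs
  · exact contDiffOn_const
  · exact ha _ _

namespace Geo

/-- Smooth chart components over an open set, with a nondegenerate and parallel contraction
tensor. -/
structure Regular (G : Geo n) (U : Set (E n)) : Prop where
  isOpen : IsOpen U
  smoothΓ : ContDiffOn ℝ ∞ G.Γ U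
  smoothP : ContDiffOn ℝ ∞ G.P U
  smoothf : ContDiffOn ℝ ∞ G.f U
  f_nondeg : ∀ y ∈ U, IsUnit (Matrix.of (G.f y)).det
  f_parallel : ∀ y ∈ U, ∀ i j k, pd k (fun z => G.f z i j) y
      = ∑ l, (G.Γ y l j k * G.f y i l + G.P y i l k * G.f y l j)

namespace Regular

variable {G : Geo n} {U : Set (E n)} (hG : G.Regular U)
include hG

theorem contDiffOn_Γ (i j k : Fin n) : ContDiffOn ℝ ∞ (fun y => G.Γ y i j k) U :=
  contDiffOn_pi.1 (contDiffOn_pi.1 (contDiffOn_pi.1 hG.smoothΓ i) j) k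

theorem contDiffOn_P (i j k : Fin n) : ContDiffOn ℝ ∞ (fun y => G.P y i j k) U :=
  contDiffOn_pi.1 (contDiffOn_pi.1 (contDiffOn_pi.1 hG.smoothP i) j) k

theorem contDiffOn_f (i j : Fin n) : ContDiffOn ℝ ∞ (fun y => G.f y i j) U :=
  contDiffOn_pi.1 (contDiffOn_pi.1 hG.smoothf i) j

theorem contDiffOn_finv (i j : Fin n) :
    ContDiffOn ℝ ∞ (fun y => (Matrix.of (G.f y))⁻¹ i j) U :=
  contDiffOn_inv (a := fun y => Matrix.of (G.f y)) (fun i j => hG.contDiffOn_f i j)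
    (fun y hy => (hG.f_nondeg y hy).ne_zero) i j

theorem contDiffOn_d1 {K : E n → Ten n p q} (hK : ContDiffOn ℝ ∞ K U) (k : Fin n) :
    ContDiffOn ℝ ∞ (G.d1 K k) U := by
  have h : G.d1 K k = fun x => pdT k K x + infAct (G.Γm k x) (-G.Pm k x) (K x) :=
    funext fun x => G.d1_eq K x k
  rw [h]
  exact (contDiffOn_pdT hG.isOpen hK k).add (contDiffOn_infAct
    (fun i j => hG.contDiffOn_Γ i j k) (fun i j => (hG.contDiffOn_P i j k).neg) hK)

theorem contDiffOn_covD {K : E n → Ten n p q} (hK : ContDiffOn ℝ ∞ K U) :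
    ContDiffOn ℝ ∞ (G.covD K) U :=
  contDiffOn_ten.2 fun A B => by
    have := contDiffOn_ten.1 (hG.contDiffOn_d1 hK (B (Fin.last q))) A (Fin.init B)
    simpa [d1, slice] using this

theorem contDiffOn_d2 {K : E n → Ten n p q} (hK : ContDiffOn ℝ ∞ K U) (i j : Fin n) :
    ContDiffOn ℝ ∞ (G.d2 K i j) U :=
  contDiffOn_slice i (contDiffOn_slice j (hG.contDiffOn_covD (hG.contDiffOn_covD hK)))

theorem contDiffOn_covDual {m : E n → Ten n p q} (hm : ContDiffOn ℝ ∞ m U) (k : Fin n) :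
    ContDiffOn ℝ ∞ (G.covDual k m) U := by
  have h : G.covDual k m = fun x => pdT k m x
      - infAct (G.Γm k x).transpose (-G.Pm k x).transpose (m x) :=
    funext fun x => G.covDual_eq k m x
  rw [h]
  exact (contDiffOn_pdT hG.isOpen hm k).sub (contDiffOn_infAct
    (fun i j => hG.contDiffOn_Γ j i k) (fun i j => (hG.contDiffOn_P j i k).neg) hm)

theorem contDiffOn_div1 {m : Fin n → E n → Ten n p q} (hm : ∀ i, ContDiffOn ℝ ∞ (m i) U) :
    ContDiffOn ℝ ∞ (G.div1 m) U :=
  ContDiffOn.sum fun i _ => (hG.contDiffOn_covDual (hm i) i).add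
    (ContDiffOn.sum fun l _ => (hG.contDiffOn_Γ i l i).smul (hm l))

theorem contDiffOn_div2 {m : Fin n → Fin n → E n → Ten n p q}
    (hm : ∀ i j, ContDiffOn ℝ ∞ (m i j) U) (i : Fin n) :
    ContDiffOn ℝ ∞ (G.div2 m i) U :=
  ContDiffOn.sum fun j _ => ((hG.contDiffOn_covDual (hm i j) j).add
    (ContDiffOn.sum fun l _ => (hG.contDiffOn_Γ i l j).smul (hm l j))).add
    (ContDiffOn.sum fun l _ => (hG.contDiffOn_Γ j l j).smul (hm i l))

theorem contDiffOn_gen {K : E n → Ten n p q} (hK : ContDiffOn ℝ ∞ K U) (i j : Fin n) :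
    ContDiffOn ℝ ∞ (fun y => G.gen y i j (K y)) U :=
  contDiffOn_ten.2 fun A B =>
    (ContDiffOn.sum fun s _ => ContDiffOn.sum fun l _ =>
      ((hG.contDiffOn_finv _ _).mul (hG.contDiffOn_f _ _)).mul (contDiffOn_ten.1 hK _ _)).sub
    (ContDiffOn.sum fun s _ => by
      split_ifs
      · exact contDiffOn_ten.1 hK _ _
      · exact contDiffOn_const)

theorem contDiffOn_torsion (i j k : Fin n) : ContDiffOn ℝ ∞ (fun y => G.torsion y i j k) U :=
  (hG.contDiffOn_Γ _ _ _).sub (hG.contDiffOn_Γ _ _ _)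

theorem contDiffOn_kronD (i j k : Fin n) : ContDiffOn ℝ ∞ (fun y => G.kronD y i j k) U := by
  simp only [kronD_eq]
  exact (hG.contDiffOn_Γ _ _ _).add (hG.contDiffOn_P _ _ _)

end Regular
end Geo

/-- Smoothness of the partial derivatives of a Lagrangian invariant. -/
structure Mom.Smooth (m : Mom n p q) (U : Set (E n)) : Prop where
  p0 : ContDiffOn ℝ ∞ m.p0 U
  p1 : ∀ i, ContDiffOn ℝ ∞ (m.p1 i) U
  p2 : ∀ i j, ContDiffOn ℝ ∞ (m.p2 i j) U

namespace Geo.Regular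

variable {G : Geo n} {U : Set (E n)} (hG : G.Regular U) {φ : E n → Ten n p q} {m : Mom n p q}
  (hφ : ContDiffOn ℝ ∞ φ U) (hm : m.Smooth U)

include hG hm

theorem contDiffOn_piMom (i : Fin n) : ContDiffOn ℝ ∞ (G.piMom m i) U :=
  (hm.p1 i).sub (hG.contDiffOn_div2 hm.p2 i)

theorem contDiffOn_eulerLagrange : ContDiffOn ℝ ∞ (G.eulerLagrange m) U :=
  (hm.p0.sub (hG.contDiffOn_div1 hm.p1)).add (hG.contDiffOn_div1 (hG.contDiffOn_div2 hm.p2))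

include hφ

theorem contDiffOn_canon (i j : Fin n) : ContDiffOn ℝ ∞ (fun y => G.canon φ m y i j) U :=
  (contDiffOn_pair (hG.contDiffOn_piMom hm j) (hG.contDiffOn_d1 hφ i)).add
    (ContDiffOn.sum fun k _ => contDiffOn_pair (hm.p2 k j) (hG.contDiffOn_d2 hφ k i))

theorem contDiffOn_spin (i j k : Fin n) : ContDiffOn ℝ ∞ (fun y => G.spin φ m y i j k) U :=
  ((contDiffOn_pair (hG.contDiffOn_piMom hm k) (hG.contDiffOn_gen hφ i j)).add
    (ContDiffOn.sum fun l _ => contDiffOn_pair (hm.p2 l k)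
      (hG.contDiffOn_gen (hG.contDiffOn_d1 hφ l) i j))).sub
    (contDiffOn_pair (hm.p2 j k) (hG.contDiffOn_d1 hφ i))

theorem contDiffOn_superpot (i j k : Fin n) :
    ContDiffOn ℝ ∞ (fun y => G.superpot φ m y i j k) U :=
  ((hG.contDiffOn_spin hφ hm i j k).sub (hG.contDiffOn_spin hφ hm i k j)).div_const 2

theorem contDiffOn_spinSym (i j k : Fin n) :
    ContDiffOn ℝ ∞ (fun y => G.spinSym φ m y i j k) U :=
  ((hG.contDiffOn_spin hφ hm i j k).add (hG.contDiffOn_spin hφ hm i k j)).div_const 2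

theorem contDiffOn_torsK (i j : Fin n) : ContDiffOn ℝ ∞ (fun y => G.torsK φ m y i j) U :=
  (ContDiffOn.sum fun k _ => ContDiffOn.sum fun l _ =>
    (hG.contDiffOn_torsion k l j).mul (hG.contDiffOn_superpot hφ hm i k l)).div_const 2

theorem contDiffOn_kronTerm (i j : Fin n) : ContDiffOn ℝ ∞ (fun y => G.kronTerm φ m y i j) U :=
  (ContDiffOn.sum fun l _ => ContDiffOn.sum fun k _ => ContDiffOn.sum fun r _ =>
    (hG.contDiffOn_kronD r l k).mul (contDiffOn_pair (hm.p2 l k)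
      (hG.contDiffOn_gen (hG.contDiffOn_d1 hφ r) i j))).sub
  (ContDiffOn.sum fun r _ => ContDiffOn.sum fun k _ => (hG.contDiffOn_kronD j r k).mul
    ((contDiffOn_pair (hG.contDiffOn_piMom hm k) (hG.contDiffOn_gen hφ i r)).add
      (ContDiffOn.sum fun l _ => contDiffOn_pair (hm.p2 l k)
        (hG.contDiffOn_gen (hG.contDiffOn_d1 hφ l) i r))))

omit hφ hm in
theorem contDiffOn_covDiv {K : E n → Ten n (p + 1) q} (hK : ContDiffOn ℝ ∞ K U) :
    ContDiffOn ℝ ∞ (G.covDiv K) U :=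
  contDiffOn_ten.2 fun _ _ => ContDiffOn.sum fun _ _ =>
    contDiffOn_ten.1 (hG.contDiffOn_covD hK) _ _

theorem contDiffOn_thetaPart : ContDiffOn ℝ ∞ (G.thetaPart φ m) U :=
  ((contDiffOn_ten.2 fun A B => hG.contDiffOn_canon hφ hm (B 0) (A 0)).sub
    (contDiffOn_ten.2 fun A B => hG.contDiffOn_torsK hφ hm (B 0) (A 0))).sub
    (hG.contDiffOn_covDiv (K := fun y => ten21 (G.superpot φ m y))
      (contDiffOn_ten.2 fun A B => hG.contDiffOn_superpot hφ hm (B 0) (A 0) (A 1)))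

theorem contDiffOn_belinfantePart : ContDiffOn ℝ ∞ (G.belinfantePart φ m) U :=
  ((hG.contDiffOn_covDiv (K := fun y => ten21 (G.spinSym φ m y))
      (contDiffOn_ten.2 fun A B => hG.contDiffOn_spinSym hφ hm (B 0) (A 0) (A 1))).add
    (contDiffOn_ten.2 fun A B => hG.contDiffOn_kronTerm hφ hm (B 0) (A 0))).sub
    (contDiffOn_ten.2 fun A B => hG.contDiffOn_torsK hφ hm (B 0) (A 0))

theorem contDiffOn_QPart : ContDiffOn ℝ ∞ (G.QPart φ m) U :=
  contDiffOn_ten.2 fun A B => contDiffOn_pair (hG.contDiffOn_eulerLagrange hm)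
    (hG.contDiffOn_gen hφ (B 0) (A 0))

end Geo.Regular

/-! ### Covariant derivative of the generators that preserve the contraction tensor -/

theorem pdT_infAct {k : Fin n} {a b : E n → Matrix (Fin n) (Fin n) ℝ} {K : E n → Ten n p q}
    {x : E n} (ha : ∀ i j, DifferentiableAt ℝ (fun y => a y i j) x)
    (hb : ∀ i j, DifferentiableAt ℝ (fun y => b y i j) x) (hK : DifferentiableAt ℝ K x) :
    pdT k (fun y => infAct (a y) (b y) (K y)) x
      = infAct (Matrix.of fun i j => pd k (fun y => a y i j) x)
          (Matrix.of fun i j => pd k (fun y => b y i j) x) (K x)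
        + infAct (a x) (b x) (pdT k K x) := by
  ext A B
  have h1 : ∀ (s : Fin p) (l : Fin n),
      DifferentiableAt ℝ (fun y => a y (A s) l * K y (update A s l) B) x :=
    fun s l => (ha _ _).mul (Ten.differentiableAt hK _ _)
  have h2 : ∀ (s : Fin q) (l : Fin n),
      DifferentiableAt ℝ (fun y => b y l (B s) * K y A (update B s l)) x :=
    fun s l => (hb _ _).mul (Ten.differentiableAt hK _ _)
  simp only [pdT, infAct, slotAct, Pi.add_apply, Matrix.transpose_apply]
  rw [pd_sub (DifferentiableAt.fun_sum fun s _ => DifferentiableAt.fun_sum fun l _ => h1 s l)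
      (DifferentiableAt.fun_sum fun s _ => DifferentiableAt.fun_sum fun l _ => h2 s l),
    pd_sum (fun s _ => DifferentiableAt.fun_sum fun l _ => h1 s l),
    pd_sum (fun s _ => DifferentiableAt.fun_sum fun l _ => h2 s l)]
  have e1 : ∀ s : Fin p, pd k (fun y => ∑ l, a y (A s) l * K y (update A s l) B) x
      = ∑ l, (pd k (fun y => a y (A s) l) x * K x (update A s l) B
        + a x (A s) l * pd k (fun y => K y (update A s l) B) x) := fun s => by
    rw [pd_sum fun l _ => h1 s l]
    exact Finset.sum_congr rfl fun l _ => pd_mul (ha _ _) (Ten.differentiableAt hK _ _)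
  have e2 : ∀ s : Fin q, pd k (fun y => ∑ l, b y l (B s) * K y A (update B s l)) x
      = ∑ l, (pd k (fun y => b y l (B s)) x * K x A (update B s l)
        + b x l (B s) * pd k (fun y => K y A (update B s l)) x) := fun s => by
    rw [pd_sum fun l _ => h2 s l]
    exact Finset.sum_congr rfl fun l _ => pd_mul (hb _ _) (Ten.differentiableAt hK _ _)
  simp only [e1, e2, Finset.sum_add_distrib, Matrix.of_apply]
  ring

namespace Geo

variable (G : Geo n)

/-- `f⁻¹ c f`. -/
def conj (x : E n) (c : Matrix (Fin n) (Fin n) ℝ) : Matrix (Fin n) (Fin n) ℝ :=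
  (Matrix.of (G.f x))⁻¹ * c * Matrix.of (G.f x)

theorem conj_single (x : E n) (i j A m : Fin n) :
    G.conj x (Matrix.single i j 1) A m = (Matrix.of (G.f x))⁻¹ A i * G.f x j m := by
  simp [conj, Matrix.mul_apply, Matrix.single_apply, ite_and]

theorem gen_eq (x : E n) (i j : Fin n) (K : Ten n p q) :
    G.gen x i j K = infAct (G.conj x (Matrix.single i j 1)) (Matrix.single i j 1) K := by
  ext A B
  simp only [gen, infAct, slotAct, conj_single, Matrix.transpose_apply, Matrix.single_apply]
  congr 1
  refine Finset.sum_congr rfl fun t _ => ?_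
  simp [ite_and, eq_comm]

theorem gen_smul (x : E n) (i j : Fin n) (c : ℝ) (K : Ten n p q) :
    G.gen x i j (c • K) = c • G.gen x i j K := by
  simp only [gen_eq, infAct_smul]

theorem gen_sum {ι : Type*} (u : Finset ι) (x : E n) (i j : Fin n) (K : ι → Ten n p q) :
    G.gen x i j (∑ l ∈ u, K l) = ∑ l ∈ u, G.gen x i j (K l) := by
  simp only [gen_eq, infAct_sum]

/-- Both `c` and f⁻¹ c f are linear in `c`, so it suffices to expand in elementary matrices. This
lets the commutators arising from differentiation be written again through the generators. -/
theorem infAct_conj (x : E n) (c : Matrix (Fin n) (Fin n) ℝ) (K : Ten n p q) :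
    infAct (G.conj x c) c K = ∑ i, ∑ j, c i j • G.gen x i j K := by
  have h : c = ∑ i, ∑ j, c i j • Matrix.single i j (1 : ℝ) := by
    conv_lhs => rw [Matrix.matrix_eq_sum_single c]
    simp
  have h2 : G.conj x c = ∑ i, ∑ j, c i j • G.conj x (Matrix.single i j (1 : ℝ)) := by
    conv_lhs => rw [h]
    simp only [conj, Matrix.mul_sum, Matrix.sum_mul, Matrix.mul_smul, Matrix.smul_mul]
  conv_lhs => rw [h2]; arg 2; rw [h]
  rw [infAct_sum_left]
  refine Finset.sum_congr rfl fun i _ => ?_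
  rw [infAct_sum_left]
  refine Finset.sum_congr rfl fun j _ => ?_
  rw [infAct_smul_left, gen_eq]

namespace Regular

variable {G} {U : Set (E n)} (hG : G.Regular U) {x : E n} (hx : x ∈ U)
include hG hx

omit hG in
theorem _root_.ContDiffOn.differentiableAt_of_isOpen {F : Type*} [NormedAddCommGroup F]
    [NormedSpace ℝ F] {K : E n → F} (hK : ContDiffOn ℝ ∞ K U) (hU : IsOpen U) :
    DifferentiableAt ℝ K x :=
  (hK.contDiffAt (hU.mem_nhds hx)).differentiableAt (by simp)

theorem pd_f (k : Fin n) : (Matrix.of fun i j => pd k (fun y => G.f y i j) x)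
    = Matrix.of (G.f x) * G.Γm k x + G.Pm k x * Matrix.of (G.f x) := by
  ext i j
  simp [hG.f_parallel x hx, Matrix.mul_apply, Γm, Pm, Finset.sum_add_distrib, mul_comm]

/-- Differentiate f⁻¹ f = 1, insert `pd_f`, and multiply by f⁻¹ on the right. -/
theorem pd_finv (k : Fin n) : (Matrix.of fun i j => pd k (fun y => (Matrix.of (G.f y))⁻¹ i j) x)
    = -(G.Γm k x * (Matrix.of (G.f x))⁻¹) - (Matrix.of (G.f x))⁻¹ * G.Pm k x := by
  set h := (Matrix.of (G.f x))⁻¹ with hh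
  set h' := (Matrix.of fun i j => pd k (fun y => (Matrix.of (G.f y))⁻¹ i j) x) with hh'
  have hfd : ∀ i j, DifferentiableAt ℝ (fun y => G.f y i j) x := fun i j =>
    (hG.contDiffOn_f i j).differentiableAt_of_isOpen hx hG.isOpen
  have hid : ∀ i j, DifferentiableAt ℝ (fun y => (Matrix.of (G.f y))⁻¹ i j) x := fun i j =>
    (hG.contDiffOn_finv i j).differentiableAt_of_isOpen hx hG.isOpen
  have key : h' * Matrix.of (G.f x)
      + h * (Matrix.of fun i j => pd k (fun y => G.f y i j) x) = 0 := by
    ext i j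
    have : pd k (fun y => ∑ l, (Matrix.of (G.f y))⁻¹ i l * G.f y l j) x = 0 := by
      rw [pd_congr hG.isOpen (H := fun _ => (1 : Matrix (Fin n) (Fin n) ℝ) i j) _ hx, pd_const]
      intro y hy
      rw [← Matrix.nonsing_inv_mul _ (hG.f_nondeg y hy), Matrix.mul_apply]
      rfl
    rw [pd_sum fun l _ => (hid i l).fun_mul (hfd l j)] at this
    refine Eq.trans ?_ this
    simp only [Matrix.add_apply, Matrix.mul_apply, ← Finset.sum_add_distrib]
    refine Finset.sum_congr rfl fun l _ => ?_
    rw [pd_mul (hid i l) (hfd l j)]; rfl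
  rw [hG.pd_f hx] at key
  have hfi : Matrix.of (G.f x) * h = 1 := Matrix.mul_nonsing_inv _ (hG.f_nondeg x hx)
  have hif : h * Matrix.of (G.f x) = 1 := Matrix.nonsing_inv_mul _ (hG.f_nondeg x hx)
  have k2 := congrArg (· * h) key
  simp only [add_mul, mul_add, zero_mul] at k2
  rw [mul_assoc, hfi, mul_one, ← mul_assoc h, hif, one_mul, mul_assoc h (_ * _) h, mul_assoc _ _ h,
    hfi, mul_one] at k2
  rw [eq_sub_iff_add_eq, ← sub_eq_zero, ← k2]; abel

/-- As `f` is parallel, the Γ contributions of f⁻¹ and `f` cancel the commutator with Γ, and only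
the P contributions, standing between f⁻¹ and `f`, survive. Hence differentiation does not lead out
of the subalgebra of pairs (f⁻¹ c f, c). -/
theorem pd_conj (k : Fin n) (c : Matrix (Fin n) (Fin n) ℝ) :
    (Matrix.of fun i j => pd k (fun y => G.conj y c i j) x)
      + (G.Γm k x * G.conj x c - G.conj x c * G.Γm k x)
      = G.conj x (c * G.Pm k x - G.Pm k x * c) := by
  have hfd : ∀ i j, DifferentiableAt ℝ (fun y => G.f y i j) x := fun i j =>
    (hG.contDiffOn_f i j).differentiableAt_of_isOpen hx hG.isOpen
  have hid : ∀ i j, DifferentiableAt ℝ (fun y => (Matrix.of (G.f y))⁻¹ i j) x := fun i j =>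
    (hG.contDiffOn_finv i j).differentiableAt_of_isOpen hx hG.isOpen
  have h1 : (Matrix.of fun i j => pd k (fun y => G.conj y c i j) x)
      = (Matrix.of fun i j => pd k (fun y => (Matrix.of (G.f y))⁻¹ i j) x) * c
          * Matrix.of (G.f x)
        + (Matrix.of (G.f x))⁻¹ * c * (Matrix.of fun i j => pd k (fun y => G.f y i j) x) := by
    ext i j
    have hd : ∀ r s, DifferentiableAt ℝ
        (fun y => (Matrix.of (G.f y))⁻¹ i s * c s r) x :=
      fun r s => (hid _ _).mul_const _
    simp only [conj, Matrix.mul_apply, Matrix.of_apply, Matrix.add_apply]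
    rw [pd_sum fun r _ => (DifferentiableAt.fun_sum fun s _ => hd r s).fun_mul (hfd r j),
      ← Finset.sum_add_distrib]
    refine Finset.sum_congr rfl fun r _ => ?_
    rw [pd_mul (DifferentiableAt.fun_sum fun s _ => hd r s) (hfd r j), pd_sum fun s _ => hd r s]
    congr 2
    refine Finset.sum_congr rfl fun s _ => ?_
    rw [pd_mul (hid i s) (differentiableAt_const _), pd_const]; ring
  rw [h1, hG.pd_f hx, hG.pd_finv hx]
  have hfi : Matrix.of (G.f x) * (Matrix.of (G.f x))⁻¹ = 1 :=
    Matrix.mul_nonsing_inv _ (hG.f_nondeg x hx)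
  simp only [conj]
  noncomm_ring

theorem differentiableAt_conj (c : Matrix (Fin n) (Fin n) ℝ) (i j : Fin n) :
    DifferentiableAt ℝ (fun y => G.conj y c i j) x := by
  have hfd : ∀ i j, DifferentiableAt ℝ (fun y => G.f y i j) x := fun i j =>
    (hG.contDiffOn_f i j).differentiableAt_of_isOpen hx hG.isOpen
  have hid : ∀ i j, DifferentiableAt ℝ (fun y => (Matrix.of (G.f y))⁻¹ i j) x := fun i j =>
    (hG.contDiffOn_finv i j).differentiableAt_of_isOpen hx hG.isOpen
  simp only [conj, Matrix.mul_apply, Matrix.of_apply]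
  exact DifferentiableAt.fun_sum fun r _ =>
    (DifferentiableAt.fun_sum fun s _ => (hid _ _).mul_const _).mul (hfd r j)

/-- The added Γ and P terms treat `j` as an upper and `i` as a lower tensor index. The commutator of
`e` with P cancels the term on `i`, but on `j` it adds P to Γ; this failure of the generator to be
parallel is the derivative of the Kronecker tensor. -/
theorem d1_gen {K : E n → Ten n p q} (hK : DifferentiableAt ℝ K x) (i j k : Fin n) :
    G.d1 (fun y => G.gen y i j (K y)) k x + (∑ l, G.Γ x j l k • G.gen x i l (K x))
        + ∑ l, G.P x l i k • G.gen x l j (K x)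
      = G.gen x i j (G.d1 K k x) + ∑ m, G.kronD x j m k • G.gen x i m (K x) := by
  set e : Matrix (Fin n) (Fin n) ℝ := Matrix.single i j 1 with he
  have hc := infAct_commutator (G.Γm k x) (-G.Pm k x) (G.conj x e) e (K x)
  have h0 : (Matrix.of fun i j => pd k (fun _ : E n => e i j) x) = 0 := by
    ext; simp [pd_const]
  have h1 : G.d1 (fun y => G.gen y i j (K y)) k x = G.gen x i j (G.d1 K k x)
      + infAct (G.conj x (e * G.Pm k x - G.Pm k x * e)) (e * G.Pm k x - G.Pm k x * e) (K x) := by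
    simp only [gen_eq, d1_eq, ← he]
    rw [pdT_infAct (b := fun _ => e) (hG.differentiableAt_conj hx e) (fun _ _ => differentiableAt_const _) hK, h0,
      infAct_add, ← hG.pd_conj hx]
    -- The summand 0 is the derivative of the constant covariant matrix `e`. The split matches the
    -- two summands on the left of `pd_conj`.
    have : e * G.Pm k x - G.Pm k x * e = 0 + (-G.Pm k x * e - e * (-G.Pm k x)) := by noncomm_ring
    rw [this, infAct_add_left, ← hc]
    abel
  have h2 : infAct (G.conj x (e * G.Pm k x - G.Pm k x * e)) (e * G.Pm k x - G.Pm k x * e) (K x)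
      = ∑ m, G.P x j m k • G.gen x i m (K x) - ∑ l, G.P x l i k • G.gen x l j (K x) := by
    rw [infAct_conj]
    simp only [Matrix.sub_apply, sub_smul, Finset.sum_sub_distrib, Matrix.mul_apply, he,
      Matrix.single_apply, Pm, Matrix.of_apply, ite_and, Finset.sum_smul]
    simp
  rw [h1, h2]
  simp only [kronD_eq, add_smul, Finset.sum_add_distrib]
  abel

end Regular
end Geo

/-! ### Divergencies of contractions, and the second identity for a single field -/

theorem sum_swap_outer (F : Fin n → Fin n → Fin n → ℝ) :
    ∑ l, ∑ k, ∑ r, F l k r = ∑ l, ∑ k, ∑ r, F r k l := by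
  rw [Finset.sum_comm, Finset.sum_comm (s := Finset.univ) (f := fun l k => ∑ r, F r k l)]
  exact Finset.sum_congr rfl fun k _ => Finset.sum_comm

namespace Geo

variable (G : Geo n)

theorem d1_add {K K' : E n → Ten n p q} {x : E n} (hK : DifferentiableAt ℝ K x)
    (hK' : DifferentiableAt ℝ K' x) (k : Fin n) :
    G.d1 (K + K') k x = G.d1 K k x + G.d1 K' k x := by
  have : pdT k (K + K') x = pdT k K x + pdT k K' x := pdT_add hK hK'
  rw [d1_eq, d1_eq, d1_eq, this, Pi.add_apply, infAct_add]; abel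

theorem covDiv_apply (K : E n → Ten n (p + 1) q) (x : E n) (A : Fin p → Fin n)
    (B : Fin q → Fin n) : G.covDiv K x A B = ∑ j, G.d1 K j x (Fin.snoc A j) B := rfl

theorem covDiv_add {K K' : E n → Ten n (p + 1) q} {x : E n} (hK : DifferentiableAt ℝ K x)
    (hK' : DifferentiableAt ℝ K' x) :
    G.covDiv (K + K') x = G.covDiv K x + G.covDiv K' x := by
  ext A B
  simp [covDiv_apply, G.d1_add hK hK', Finset.sum_add_distrib]

theorem covDiv_congr {U : Set (E n)} (hU : IsOpen U) {K K' : E n → Ten n (p + 1) q}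
    (h : ∀ y ∈ U, K y = K' y) {x : E n} (hx : x ∈ U) : G.covDiv K x = G.covDiv K' x := by
  ext A B
  simp only [covDiv_apply, d1_eq, h x hx]
  refine Finset.sum_congr rfl fun j _ => ?_
  have : pdT j K x = pdT j K' x := by
    ext A B
    exact pd_congr hU (fun y hy => by rw [h y hy]) hx
  rw [this]

/-- Divergency of components `h_i^{jk}` over the last index. -/
def div21 (h : E n → Fin n → Fin n → Fin n → ℝ) (x : E n) (i j : Fin n) : ℝ :=
  ∑ k, (pd k (fun y => h y i j k) x + (∑ l, G.Γ x j l k * h x i l k)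
    + (∑ l, G.Γ x k l k * h x i j l) + ∑ l, G.P x l i k * h x l j k)

theorem div21_add {h h' : E n → Fin n → Fin n → Fin n → ℝ} {x : E n}
    (hh : ∀ i j k, DifferentiableAt ℝ (fun y => h y i j k) x)
    (hh' : ∀ i j k, DifferentiableAt ℝ (fun y => h' y i j k) x) (i j : Fin n) :
    G.div21 (fun y i j k => h y i j k + h' y i j k) x i j = G.div21 h x i j + G.div21 h' x i j := by
  simp only [div21, pd_add (hh _ _ _) (hh' _ _ _), mul_add, Finset.sum_add_distrib]; ring

theorem div21_sub {h h' : E n → Fin n → Fin n → Fin n → ℝ} {x : E n}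
    (hh : ∀ i j k, DifferentiableAt ℝ (fun y => h y i j k) x)
    (hh' : ∀ i j k, DifferentiableAt ℝ (fun y => h' y i j k) x) (i j : Fin n) :
    G.div21 (fun y i j k => h y i j k - h' y i j k) x i j = G.div21 h x i j - G.div21 h' x i j := by
  simp only [div21, pd_sub (hh _ _ _) (hh' _ _ _), mul_sub, Finset.sum_add_distrib,
    Finset.sum_sub_distrib]
  ring

theorem div21_sum {ι : Type*} {u : Finset ι} {h : ι → E n → Fin n → Fin n → Fin n → ℝ} {x : E n}
    (hh : ∀ r i j k, DifferentiableAt ℝ (fun y => h r y i j k) x) (i j : Fin n) :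
    G.div21 (fun y i j k => ∑ r ∈ u, h r y i j k) x i j = ∑ r ∈ u, G.div21 (h r) x i j := by
  simp only [div21, pd_sum fun r _ => hh r _ _ _, Finset.mul_sum]
  rw [Finset.sum_comm]
  refine Finset.sum_congr rfl fun k _ => ?_
  simp only [Finset.sum_add_distrib]
  rw [Finset.sum_comm, Finset.sum_comm (f := fun l r => G.Γ x k l k * _),
    Finset.sum_comm (f := fun l r => G.P x l i k * _)]

/-- The divergency index of `m` is the only free one, so its Γ term goes entirely into `div1`. -/
theorem pair_div1 {m : Fin n → E n → Ten n p q} {K : E n → Ten n p q} {x : E n}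
    (hm : ∀ i, DifferentiableAt ℝ (m i) x) (hK : DifferentiableAt ℝ K x) :
    ∑ k, (pd k (fun y => pair (m k y) (K y)) x + ∑ l, G.Γ x k l k * pair (m l x) (K x))
      = pair (G.div1 m x) (K x) + ∑ k, pair (m k x) (G.d1 K k x) := by
  simp only [div1, pair_sum_left, pair_add_left, pair_smul_left, G.pd_pair_covDual (hm _) hK,
    Finset.sum_add_distrib]
  ring

/-- In `div1 (m l)` the index `l` is a label, in `div2` it is a contravariant index; the difference
is its Γ term. -/
theorem div1_eq_div2 (m : Fin n → Fin n → E n → Ten n p q) (l : Fin n) (x : E n) :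
    G.div1 (m l) x = G.div2 m l x - ∑ k, ∑ r, G.Γ x l r k • m r k x := by
  simp only [div1, div2, Finset.sum_add_distrib]; abel

theorem div21_pair {m : Fin n → E n → Ten n p q} {K : Fin n → Fin n → E n → Ten n p q} {x : E n}
    (hm : ∀ i, DifferentiableAt ℝ (m i) x) (hK : ∀ i j, DifferentiableAt ℝ (K i j) x)
    (i j : Fin n) :
    G.div21 (fun y i j k => pair (m k y) (K i j y)) x i j
      = pair (G.div1 m x) (K i j x) + ∑ k, pair (m k x) (G.d1 (K i j) k x
        + (∑ l, G.Γ x j l k • K i l x) + ∑ l, G.P x l i k • K l j x) := by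
  have := G.pair_div1 hm (hK i j)
  simp only [pair_add_right, pair_sum_right, pair_smul_right, Finset.sum_add_distrib, div21]
    at this ⊢
  linear_combination this

theorem div2_pair {m : Fin n → Fin n → E n → Ten n p q} {φ : E n → Ten n p q} {x : E n}
    (hm : ∀ i j, DifferentiableAt ℝ (m i j) x) (hφ : ∀ i, DifferentiableAt ℝ (G.d1 φ i) x)
    (i j : Fin n) :
    G.div21 (fun y i j k => pair (m j k y) (G.d1 φ i y)) x i j
      = pair (G.div2 m j x) (G.d1 φ i x) + ∑ k, pair (m j k x) (G.d2 φ i k x) := by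
  have := G.pair_div1 (hm j) (hφ i)
  simp only [div1_eq_div2, pair_sub_left, d2_eq, pair_add_right, pair_sum_left, pair_smul_left,
    pair_sum_right, pair_smul_right, Finset.sum_add_distrib, div21] at this ⊢
  linear_combination this

theorem div1_sub {m m' : Fin n → E n → Ten n p q} {x : E n}
    (hm : ∀ i, DifferentiableAt ℝ (m i) x) (hm' : ∀ i, DifferentiableAt ℝ (m' i) x) :
    G.div1 (fun i y => m i y - m' i y) x = G.div1 m x - G.div1 m' x := by
  have h : ∀ i, G.covDual i (fun y => m i y - m' i y) x
      = G.covDual i (m i) x - G.covDual i (m' i) x := by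
    intro i
    have : pdT i (fun y => m i y - m' i y) x = pdT i (m i) x - pdT i (m' i) x := by
      ext A B
      exact pd_sub (Ten.differentiableAt (hm i) A B) (Ten.differentiableAt (hm' i) A B)
    rw [covDual_eq, covDual_eq, covDual_eq, this, infAct_sub]; abel
  simp only [div1, h, smul_sub, Finset.sum_add_distrib, Finset.sum_sub_distrib]; abel

/-- Change of the Lagrangian invariant under the generator `(i, j)`, as far as it is due to the
field `φ`. -/
def genChange (φ : E n → Ten n p q) (m : Mom n p q) (x : E n) (i j : Fin n) : ℝ :=
  pair (m.p0 x) (G.gen x i j (φ x))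
    + (∑ k, pair (m.p1 k x) (G.gen x i j (G.d1 φ k x))) - pair (m.p1 j x) (G.d1 φ i x)
    + (∑ l, ∑ k, pair (m.p2 l k x) (G.gen x i j (G.d2 φ l k x)))
    - (∑ k, pair (m.p2 j k x) (G.d2 φ i k x)) - ∑ k, pair (m.p2 k j x) (G.d2 φ k i x)

namespace Regular

variable {G} {U : Set (E n)} (hG : G.Regular U) {x : E n} (hx : x ∈ U)
  {φ : E n → Ten n p q} {m : Mom n p q} (hφ : ContDiffOn ℝ ∞ φ U) (hm : m.Smooth U)

include hG hx

theorem div21_gen {μ : Fin n → E n → Ten n p q} {ψ : E n → Ten n p q}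
    (hμ : ∀ i, ContDiffOn ℝ ∞ (μ i) U) (hψ : ContDiffOn ℝ ∞ ψ U) (i j : Fin n) :
    G.div21 (fun y i j k => pair (μ k y) (G.gen y i j (ψ y))) x i j
      = pair (G.div1 μ x) (G.gen x i j (ψ x)) + (∑ k, pair (μ k x) (G.gen x i j (G.d1 ψ k x)))
        + ∑ k, ∑ r, G.kronD x j r k * pair (μ k x) (G.gen x i r (ψ x)) := by
  rw [G.div21_pair (fun i => (hμ i).differentiableAt_of_isOpen hx hG.isOpen)
    (K := fun i j y => G.gen y i j (ψ y))
    (fun i j => (hG.contDiffOn_gen hψ i j).differentiableAt_of_isOpen hx hG.isOpen)]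
  simp only [hG.d1_gen hx (hψ.differentiableAt_of_isOpen hx hG.isOpen), pair_add_right,
    pair_sum_right, pair_smul_right, Finset.sum_add_distrib, add_assoc]

include hφ hm

/-- Termwise product rule. Kronecker derivatives enter twice: through `d1_gen`, and through the
contracted index `l` of ∂L/∂φ_{;l;k} and φ_{;l}, whose missing Γ and P terms add up. Together they
are exactly the negative of `kronTerm`. -/
theorem div21_spin (i j : Fin n) :
    G.div21 (G.spin φ m) x i j
      = pair (G.div1 (G.piMom m) x) (G.gen x i j (φ x))
        + (∑ k, pair (G.piMom m k x) (G.gen x i j (G.d1 φ k x)))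
        + (∑ l, pair (G.div2 m.p2 l x) (G.gen x i j (G.d1 φ l x)))
        + (∑ l, ∑ k, pair (m.p2 l k x) (G.gen x i j (G.d2 φ l k x)))
        - pair (G.div2 m.p2 j x) (G.d1 φ i x) - (∑ k, pair (m.p2 j k x) (G.d2 φ i k x))
        - G.kronTerm φ m x i j := by
  have hd1 := hG.contDiffOn_d1 hφ
  have hπ := hG.contDiffOn_piMom hm
  have s1 : ∀ i j k, DifferentiableAt ℝ
      (fun y => pair (G.piMom m k y) (G.gen y i j (φ y))) x := fun i j k =>
    (contDiffOn_pair (hπ k) (hG.contDiffOn_gen hφ i j)).differentiableAt_of_isOpen hx hG.isOpen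
  have s2 : ∀ l i j k, DifferentiableAt ℝ
      (fun y => pair (m.p2 l k y) (G.gen y i j (G.d1 φ l y))) x := fun l i j k =>
    (contDiffOn_pair (hm.p2 l k)
      (hG.contDiffOn_gen (hd1 l) i j)).differentiableAt_of_isOpen hx hG.isOpen
  have s3 : ∀ i j k, DifferentiableAt ℝ (fun y => pair (m.p2 j k y) (G.d1 φ i y)) x :=
    fun i j k =>
      (contDiffOn_pair (hm.p2 j k) (hd1 i)).differentiableAt_of_isOpen hx hG.isOpen
  have h0 : G.div21 (G.spin φ m) x i j
      = G.div21 (fun y i j k => pair (G.piMom m k y) (G.gen y i j (φ y))) x i j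
        + (∑ l, G.div21 (fun y i j k => pair (m.p2 l k y) (G.gen y i j (G.d1 φ l y))) x i j)
        - G.div21 (fun y i j k => pair (m.p2 j k y) (G.d1 φ i y)) x i j := by
    rw [← G.div21_sum s2, ← G.div21_add s1 fun i j k => DifferentiableAt.fun_sum fun l _ =>
      s2 l i j k, ← G.div21_sub (fun i j k => (s1 i j k).fun_add (DifferentiableAt.fun_sum fun l _ =>
      s2 l i j k)) s3]
    rfl
  have h1 := hG.div21_gen hx hπ hφ i j
  have h2 := fun l => hG.div21_gen hx (hm.p2 l) (hd1 l) i j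
  have h3 := G.div2_pair
    (fun i j => (hm.p2 i j).differentiableAt_of_isOpen hx hG.isOpen)
    (fun i => (hd1 i).differentiableAt_of_isOpen hx hG.isOpen) i j
  have hd : ∀ l k, G.d1 (G.d1 φ l) k x = G.d2 φ l k x - ∑ r, G.P x r l k • G.d1 φ r x :=
    fun l k => by rw [d2_eq]; abel
  have gen_sub : ∀ K K' : Ten n p q, G.gen x i j (K - K') = G.gen x i j K - G.gen x i j K' :=
    fun K K' => by simp only [gen_eq, infAct_sub]
  rw [h0, h1, h3]
  simp only [h2, div1_eq_div2 G m.p2, hd, gen_sub, gen_sum, gen_smul, pair_sub_left,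
    pair_sub_right, pair_sum_left, pair_sum_right, pair_smul_left, pair_smul_right,
    Finset.sum_add_distrib, Finset.sum_sub_distrib, kronTerm, mul_add, Finset.mul_sum]
  -- Exchanging the names of `l` and `r` gives the Γ term the shape of the P term, so that `e2` can
  -- merge them.
  have e1 := sum_swap_outer fun l k r =>
    G.Γ x l r k * pair (m.p2 r k x) (G.gen x i j (G.d1 φ l x))
  have e2 : ∑ l, ∑ k, ∑ r, G.kronD x r l k * pair (m.p2 l k x) (G.gen x i j (G.d1 φ r x))
      = (∑ l, ∑ k, ∑ r, G.Γ x r l k * pair (m.p2 l k x) (G.gen x i j (G.d1 φ r x)))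
        + ∑ l, ∑ k, ∑ r, G.P x r l k * pair (m.p2 l k x) (G.gen x i j (G.d1 φ r x)) := by
    simp only [kronD_eq, add_mul, Finset.sum_add_distrib]
  have e3 : ∑ r, ∑ k, G.kronD x j r k * pair (G.piMom m k x) (G.gen x i r (φ x))
      = ∑ k, ∑ r, G.kronD x j r k * pair (G.piMom m k x) (G.gen x i r (φ x)) := Finset.sum_comm
  have e4 : ∑ r, ∑ k, ∑ l, G.kronD x j r k * pair (m.p2 l k x) (G.gen x i r (G.d1 φ l x))
      = ∑ l, ∑ k, ∑ r, G.kronD x j r k * pair (m.p2 l k x) (G.gen x i r (G.d1 φ l x)) :=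
    sum_swap_outer _
  rw [e1, e2, e3, e4]
  ring

omit hφ in
theorem eulerLagrange_eq : G.eulerLagrange m x = m.p0 x - G.div1 (G.piMom m) x := by
  have := G.div1_sub (m := m.p1) (m' := G.div2 m.p2)
    (fun i => (hm.p1 i).differentiableAt_of_isOpen hx hG.isOpen)
    (fun i => (hG.contDiffOn_div2 hm.p2 i).differentiableAt_of_isOpen hx hG.isOpen)
  have h2 : G.div1 (G.piMom m) x = G.div1 m.p1 x - G.div1 (G.div2 m.p2) x := this
  rw [h2, eulerLagrange]
  have : (fun i => G.div2 m.p2 i) = G.div2 m.p2 := rfl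
  rw [this]; abel

/-- Replace the divergency of π by ∂L/∂φ - δL/δφ (`eulerLagrange_eq`), and the sum of π and the
divergency of ∂L/∂φ_{;i;j} by ∂L/∂φ_{;i}. What is left besides the variational term is the change
under the generator. -/
theorem canon_sub_div21_spin (i j : Fin n) :
    G.canon φ m x i j - G.div21 (G.spin φ m) x i j - G.kronTerm φ m x i j
      = pair (G.eulerLagrange m x) (G.gen x i j (φ x)) - G.genChange φ m x i j := by
  rw [hG.div21_spin hx hφ hm, hG.eulerLagrange_eq hx hm, canon, genChange]
  simp only [piMom, pair_sub_left, Finset.sum_sub_distrib]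
  ring

/-- The torsion terms cancel, and the antisymmetric and symmetric halves of U recombine to the full
divergency of U, so `canon_sub_div21_spin` applies. -/
theorem thetaPart_sub_belinfantePart :
    G.thetaPart φ m x - G.belinfantePart φ m x
      = G.QPart φ m x - ten11 (G.genChange φ m x) := by
  have h : G.covDiv (fun y => ten21 (G.superpot φ m y)) x
      + G.covDiv (fun y => ten21 (G.spinSym φ m y)) x
      = G.covDiv (fun y => ten21 (G.spin φ m y)) x := by
    rw [← G.covDiv_add]
    · congr 1
      ext y A B
      simp only [Pi.add_apply, ten21, superpot, spinSym]; ring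
    · exact ContDiffOn.differentiableAt_of_isOpen hx (contDiffOn_ten.2 fun A B =>
        hG.contDiffOn_superpot hφ hm (B 0) (A 0) (A 1)) hG.isOpen
    · exact ContDiffOn.differentiableAt_of_isOpen hx (contDiffOn_ten.2 fun A B =>
        hG.contDiffOn_spinSym hφ hm (B 0) (A 0) (A 1)) hG.isOpen
  ext A B
  have h1 := congrFun (congrFun h A) B
  rw [covDiv_ten21 G (fun y => G.spin φ m y)] at h1
  have h2 := hG.canon_sub_div21_spin hx hφ hm (B 0) (A 0)
  rw [div21] at h2
  simp only [thetaPart, belinfantePart, QPart, Pi.sub_apply, Pi.add_apply, ten11] at h1 h2 ⊢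
  linear_combination h2 - h1

end Regular
end Geo

/-! ### Double divergency of the superpotential, and the first identity for a single field -/

theorem sum_sum_antisymm {c w : Fin n → Fin n → ℝ} (hw : ∀ j l, w j l = - w l j) :
    ∑ j, ∑ l, c j l * w j l = (∑ j, ∑ l, w j l * (c j l - c l j)) / 2 := by
  have h : ∑ j, ∑ l, c j l * w j l = ∑ j, ∑ l, - (c l j * w j l) := by
    rw [Finset.sum_comm]
    exact Finset.sum_congr rfl fun j _ => Finset.sum_congr rfl fun l _ => by rw [hw]; ring
  have h2 : ∑ j, ∑ l, w j l * (c j l - c l j)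
      = (∑ j, ∑ l, c j l * w j l) + ∑ j, ∑ l, - (c l j * w j l) := by
    simp only [← Finset.sum_add_distrib]
    exact Finset.sum_congr rfl fun j _ => Finset.sum_congr rfl fun l _ => by ring
  rw [h2, ← h]; ring

theorem sum_sum_eq_zero_of_antisymm {w : Fin n → Fin n → ℝ} (hw : ∀ j l, w j l = - w l j) :
    ∑ j, ∑ l, w j l = 0 := by
  have := sum_sum_antisymm (c := fun _ _ => 1) hw
  simpa using this

namespace Geo

variable (G : Geo n)

/-- Divergency of components `h_i^j`. -/
def div11 (h : E n → Fin n → Fin n → ℝ) (x : E n) (i : Fin n) : ℝ :=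
  ∑ j, (pd j (fun y => h y i j) x + (∑ l, G.Γ x j l j * h x i l) + ∑ l, G.P x l i j * h x l j)

theorem div11_add {h h' : E n → Fin n → Fin n → ℝ} {x : E n}
    (hh : ∀ i j, DifferentiableAt ℝ (fun y => h y i j) x)
    (hh' : ∀ i j, DifferentiableAt ℝ (fun y => h' y i j) x) (i : Fin n) :
    G.div11 (fun y i j => h y i j + h' y i j) x i = G.div11 h x i + G.div11 h' x i := by
  simp only [div11, pd_add (hh _ _) (hh' _ _), mul_add, Finset.sum_add_distrib]; ring

theorem div11_sum {ι : Type*} {u : Finset ι} {h : ι → E n → Fin n → Fin n → ℝ} {x : E n}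
    (hh : ∀ r i j, DifferentiableAt ℝ (fun y => h r y i j) x) (i : Fin n) :
    G.div11 (fun y i j => ∑ r ∈ u, h r y i j) x i = ∑ r ∈ u, G.div11 (h r) x i := by
  simp only [div11, pd_sum fun r _ => hh r _ _, Finset.mul_sum]
  rw [Finset.sum_comm]
  refine Finset.sum_congr rfl fun k _ => ?_
  simp only [Finset.sum_add_distrib]
  rw [Finset.sum_comm, Finset.sum_comm (f := fun l r => G.P x l i k * _)]

theorem div11_congr {U : Set (E n)} (hU : IsOpen U) {h h' : E n → Fin n → Fin n → ℝ}
    (hh : ∀ y ∈ U, ∀ i j, h y i j = h' y i j) {x : E n} (hx : x ∈ U) (i : Fin n) :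
    G.div11 h x i = G.div11 h' x i := by
  simp only [div11, hh x hx, pd_congr hU (fun y hy => hh y hy i _) hx]

theorem div11_pair {m : Fin n → E n → Ten n p q} {K : Fin n → E n → Ten n p q} {x : E n}
    (hm : ∀ i, DifferentiableAt ℝ (m i) x) (hK : ∀ i, DifferentiableAt ℝ (K i) x) (i : Fin n) :
    G.div11 (fun y i j => pair (m j y) (K i y)) x i
      = pair (G.div1 m x) (K i x)
        + ∑ j, pair (m j x) (G.d1 (K i) j x + ∑ l, G.P x l i j • K l x) := by
  have := G.pair_div1 hm (hK i)
  simp only [pair_add_right, pair_sum_right, pair_smul_right, Finset.sum_add_distrib, div11]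
    at this ⊢
  linear_combination this

/-- Trace `γ_l = Γ^m_{lm}` of the contravariant connection. -/
def traceΓ (l : Fin n) (x : E n) : ℝ := ∑ m, G.Γ x m l m

/-- Change of the Lagrangian invariant along `∂_k`, as far as it is due to the field `φ`. -/
def fieldChange (φ : E n → Ten n p q) (m : Mom n p q) (x : E n) (k : Fin n) : ℝ :=
  pair (m.p0 x) (G.d1 φ k x) + (∑ i, pair (m.p1 i x) (G.d2 φ i k x))
    + ∑ i, ∑ j, pair (m.p2 i j x) (G.d3 φ i j k x)

/-- Against the antisymmetric `w`, the connection term on the upper index `j` sees only the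
antisymmetric part of Γ, and the torsion term removes it. This is why K accompanies the divergency
of W in θ. -/
theorem torsion_add_div21 {w : E n → Fin n → Fin n → Fin n → ℝ} {x : E n}
    (hw : ∀ k j l, w x k j l = - w x k l j) (k j : Fin n) :
    (∑ r, ∑ l, G.torsion x r l j * w x k r l) / 2 + G.div21 w x k j
      = ∑ l, (pd l (fun y => w y k j l) x + G.traceΓ l x * w x k j l
        + ∑ r, G.P x r k l * w x r j l) := by
  have h1 := sum_sum_antisymm (c := fun l m => G.Γ x j l m) (hw k)
  have h2 : ∑ r, ∑ l, G.torsion x r l j * w x k r l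
      = - ∑ r, ∑ l, w x k r l * (G.Γ x j r l - G.Γ x j l r) := by
    simp only [← Finset.sum_neg_distrib, torsion]
    exact Finset.sum_congr rfl fun r _ => Finset.sum_congr rfl fun l _ => by ring
  have h4 : ∑ l, ∑ m, G.Γ x j m l * w x k m l = ∑ l, ∑ m, G.Γ x j l m * w x k l m :=
    Finset.sum_comm
  have h5 : ∑ l, ∑ m, G.Γ x l m l * w x k j m = ∑ m, ∑ l, G.Γ x l m l * w x k j m :=
    Finset.sum_comm
  simp only [div21, Finset.sum_add_distrib, traceΓ, Finset.sum_mul]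
  rw [h2, h4, h1, h5]
  ring

/-- The second divergency of an antisymmetric superpotential is algebraic in it. -/
theorem div11_superpot {U : Set (E n)} (hG : G.Regular U) {w : E n → Fin n → Fin n → Fin n → ℝ}
    (hs : ∀ k j l, ContDiffOn ℝ ∞ (fun y => w y k j l) U)
    (hw : ∀ y k j l, w y k j l = - w y k l j) {x : E n} (hx : x ∈ U) (k : Fin n) :
    G.div11 (fun y k j => (∑ r, ∑ l, G.torsion y r l j * w y k r l) / 2 + G.div21 w y k j) x k
      = (∑ j, ∑ l, w x k j l * ((∑ r, G.curvΓ x r r j l)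
          + pd j (G.torsionTrace l) x - pd l (G.torsionTrace j) x)) / 2
        + (∑ r, ∑ j, ∑ l, w x r j l * G.curvP x r k j l) / 2 := by
  have hd : ∀ k j l, DifferentiableAt ℝ (fun y => w y k j l) x := fun k j l =>
    (hs k j l).differentiableAt_of_isOpen hx hG.isOpen
  have hpd : ∀ a k j l, DifferentiableAt ℝ (pd a fun y => w y k j l) x := fun a k j l =>
    (contDiffOn_pd hG.isOpen (hs k j l) a).differentiableAt_of_isOpen hx hG.isOpen
  have hΓ : ∀ i j k, DifferentiableAt ℝ (fun y => G.Γ y i j k) x := fun i j k =>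
    (hG.contDiffOn_Γ i j k).differentiableAt_of_isOpen hx hG.isOpen
  have hP : ∀ i j k, DifferentiableAt ℝ (fun y => G.P y i j k) x := fun i j k =>
    (hG.contDiffOn_P i j k).differentiableAt_of_isOpen hx hG.isOpen
  have hγ : ∀ l, DifferentiableAt ℝ (G.traceΓ l) x := fun l =>
    DifferentiableAt.fun_sum fun m _ => hΓ m l m
  have dw : ∀ a k j l, pd a (fun y => w y k j l) x = - pd a (fun y => w y k l j) x := by
    intro a k j l
    rw [← pd_neg]; congr 1; ext y; exact hw y k j l
  -- The quadratic terms of the contracted curvature cancel as the trace of a commutator, leaving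
  -- the curl of Γ^m_{ml}. The torsion covector is the difference of the two traces of Γ, so its
  -- curl turns this into the curl of `traceΓ`.
  have hcurv : ∀ j l, (∑ r, G.curvΓ x r r j l) + pd j (G.torsionTrace l) x
      - pd l (G.torsionTrace j) x = pd j (G.traceΓ l) x - pd l (G.traceΓ j) x := by
    intro j l
    have ht : ∀ a b, pd a (G.torsionTrace b) x
        = pd a (G.traceΓ b) x - ∑ m, pd a (fun y => G.Γ y m m b) x := by
      intro a b
      have : G.torsionTrace b = fun y => G.traceΓ b y - ∑ m, G.Γ y m m b := by
        ext y; simp [torsionTrace, traceΓ, torsion]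
      rw [this, pd_sub (hγ b) (DifferentiableAt.fun_sum fun m _ => hΓ m m b),
        pd_sum fun m _ => hΓ m m b]
    have hq : ∑ r, ∑ m, G.Γ x r m j * G.Γ x m r l = ∑ r, ∑ m, G.Γ x r m l * G.Γ x m r j := by
      rw [Finset.sum_comm]
      exact Finset.sum_congr rfl fun r _ => Finset.sum_congr rfl fun m _ => mul_comm _ _
    simp only [curvΓ, Finset.sum_add_distrib, Finset.sum_sub_distrib, ht, hq]
    ring
  have hA : (∑ j, ∑ l, w x k j l * ((∑ r, G.curvΓ x r r j l)
          + pd j (G.torsionTrace l) x - pd l (G.torsionTrace j) x)) / 2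
      = ∑ j, ∑ l, pd j (G.traceΓ l) x * w x k j l := by
    simp only [hcurv]
    exact (sum_sum_antisymm (c := fun j l => pd j (G.traceΓ l) x) (hw x k)).symm
  have hB : (∑ r, ∑ j, ∑ l, w x r j l * G.curvP x r k j l) / 2
      = ∑ r, ∑ j, ∑ l, (pd j (fun y => G.P y r k l) x + ∑ m, G.P x m k j * G.P x r m l)
          * w x r j l := by
    rw [Finset.sum_div]
    refine Finset.sum_congr rfl fun r _ => ?_
    rw [sum_sum_antisymm (hw x r)]
    simp only [curvP, Finset.sum_sub_distrib]
    congr 1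
    exact Finset.sum_congr rfl fun j _ => Finset.sum_congr rfl fun l _ => by ring
  rw [hA, hB, G.div11_congr hG.isOpen (fun y _ k j => G.torsion_add_div21 (hw y) k j) hx]
  have hexp : ∀ j, pd j (fun y => ∑ l, (pd l (fun y => w y k j l) y + G.traceΓ l y * w y k j l
        + ∑ r, G.P y r k l * w y r j l)) x
      = ∑ l, (pd j (pd l fun y => w y k j l) x + (pd j (G.traceΓ l) x * w x k j l
          + G.traceΓ l x * pd j (fun y => w y k j l) x)
        + ∑ r, (pd j (fun y => G.P y r k l) x * w x r j l
          + G.P x r k l * pd j (fun y => w y r j l) x)) := by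
    intro j
    have a1 : ∀ l, DifferentiableAt ℝ (fun y => G.traceΓ l y * w y k j l) x := fun l =>
      (hγ l).fun_mul (hd k j l)
    have a2 : ∀ l r, DifferentiableAt ℝ (fun y => G.P y r k l * w y r j l) x := fun l r =>
      (hP r k l).fun_mul (hd r j l)
    have a3 : ∀ l, DifferentiableAt ℝ (fun y => ∑ r, G.P y r k l * w y r j l) x := fun l =>
      DifferentiableAt.fun_sum fun r _ => a2 l r
    rw [pd_sum fun l _ => ((hpd l k j l).fun_add (a1 l)).fun_add (a3 l)]
    refine Finset.sum_congr rfl fun l _ => ?_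
    rw [pd_add ((hpd l k j l).fun_add (a1 l)) (a3 l), pd_add (hpd l k j l) (a1 l),
      pd_mul (hγ l) (hd k j l), pd_sum fun r _ => a2 l r]
    congr 1
    exact Finset.sum_congr rfl fun r _ => pd_mul (hP r k l) (hd r j l)
  -- By antisymmetry of `w`, the second derivatives vanish (partial derivatives commute) and so does
  -- the product of two traces; the terms γ ∂w, P ∂w and γ P w cancel in pairs. Only ∂γ, ∂P and P P
  -- remain as coefficients of `w`.
  have z1 : ∑ j, ∑ l, pd j (pd l fun y => w y k j l) x = 0 := by
    refine sum_sum_eq_zero_of_antisymm fun j l => ?_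
    rw [pd_comm hG.isOpen (hs k j l) hx, ← pd_neg]
    have : (fun y => - pd j (fun y => w y k l j) y) = pd j fun y => w y k j l := by
      ext y
      rw [← pd_neg]; congr 1; ext y; exact (hw y k j l).symm
    rw [this]
  have z2 : ∑ j, ∑ l, G.traceΓ l x * pd j (fun y => w y k j l) x
      = - ∑ j, ∑ l, G.traceΓ j x * pd l (fun y => w y k j l) x := by
    rw [Finset.sum_comm]
    simp only [← Finset.sum_neg_distrib]
    exact Finset.sum_congr rfl fun j _ => Finset.sum_congr rfl fun l _ => by rw [dw]; ring
  have z3 : ∀ r, ∑ j, ∑ l, (G.traceΓ j x * G.traceΓ l x) * w x r j l = 0 := fun r => by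
    rw [sum_sum_antisymm (hw x r)]; simp [mul_comm]
  have z4 : ∀ r, ∑ j, ∑ l, (G.traceΓ j x * G.P x r k l) * w x r j l
      = - ∑ j, ∑ l, (G.P x r k j * G.traceΓ l x) * w x r j l := fun r => by
    rw [Finset.sum_comm]
    simp only [← Finset.sum_neg_distrib]
    exact Finset.sum_congr rfl fun j _ => Finset.sum_congr rfl fun l _ => by
      rw [hw x r l j]; ring
  have z5 : ∀ r, ∑ j, ∑ l, G.P x r k l * pd j (fun y => w y r j l) x
      = - ∑ j, ∑ l, G.P x r k j * pd l (fun y => w y r j l) x := fun r => by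
    rw [Finset.sum_comm]
    simp only [← Finset.sum_neg_distrib]
    exact Finset.sum_congr rfl fun j _ => Finset.sum_congr rfl fun l _ => by rw [dw]; ring
  have rot : ∀ F : Fin n → Fin n → Fin n → ℝ,
      ∑ j, ∑ l, ∑ r, F j l r = ∑ r, ∑ j, ∑ l, F j l r := fun F => by
    rw [Finset.sum_comm (f := fun r j => ∑ l, F j l r)]
    exact Finset.sum_congr rfl fun j _ => Finset.sum_comm
  have htr : ∀ y : Fin n → ℝ, ∑ j, ∑ l, G.Γ x j l j * y l = ∑ j, G.traceΓ j x * y j := fun y => by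
    rw [Finset.sum_comm]; simp only [traceΓ, Finset.sum_mul]
  simp only [div11, hexp]
  simp only [Finset.sum_add_distrib]
  rw [htr]
  simp only [mul_add, add_mul, Finset.sum_add_distrib, Finset.mul_sum, Finset.sum_mul,
    mul_assoc] at z3 z4 ⊢
  have e1 : ∑ j, ∑ l, ∑ r, G.P x r k l * pd j (fun y => w y r j l) x
      = - ∑ j, ∑ r, ∑ l, G.P x r k j * pd l (fun y => w y r j l) x := by
    rw [rot, Finset.sum_comm (f := fun j r => ∑ l, G.P x r k j * pd l (fun y => w y r j l) x)]
    simp only [z5, Finset.sum_neg_distrib]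
  have e2 : ∑ j, ∑ l, ∑ r, G.traceΓ j x * (G.P x r k l * w x r j l)
      = - ∑ j, ∑ r, ∑ l, G.P x r k j * (G.traceΓ l x * w x r j l) := by
    rw [rot, Finset.sum_comm (f := fun j r => ∑ l, G.P x r k j * (G.traceΓ l x * w x r j l))]
    simp only [z4, Finset.sum_neg_distrib]
  have e3 : ∑ j, ∑ r, ∑ l, ∑ s, G.P x r k j * (G.P x s r l * w x s j l)
      = ∑ s, ∑ j, ∑ l, ∑ r, G.P x r k j * (G.P x s r l * w x s j l) := by
    rw [Finset.sum_comm (f := fun s j => ∑ l, ∑ r, G.P x r k j * (G.P x s r l * w x s j l))]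
    refine Finset.sum_congr rfl fun j _ => ?_
    rw [rot]
    exact Finset.sum_congr rfl fun s _ => Finset.sum_comm
  rw [z1, z2, z3 k, e1, e2, e3, rot fun j l r => pd j (fun y => G.P y r k l) x * w x r j l]
  ring

theorem covDiv_sub {K K' : E n → Ten n (p + 1) q} {x : E n} (hK : DifferentiableAt ℝ K x)
    (hK' : DifferentiableAt ℝ K' x) :
    G.covDiv (K - K') x = G.covDiv K x - G.covDiv K' x := by
  have := G.covDiv_add (hK.sub hK') hK'
  rw [sub_add_cancel] at this
  rw [this, add_sub_cancel_right]

namespace Regular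

variable {G} {U : Set (E n)} (hG : G.Regular U) {x : E n} (hx : x ∈ U)
  {φ : E n → Ten n p q} {m : Mom n p q} (hφ : ContDiffOn ℝ ∞ φ U) (hm : m.Smooth U)

include hG hx hφ hm

/-- As in `div21_spin`, the contracted index `k` of ∂L/∂φ_{;k;j} and φ_{;k;i} leaves the Kronecker
derivative Γ + P. -/
theorem div11_canon (i : Fin n) :
    G.div11 (G.canon φ m) x i
      = pair (G.div1 (G.piMom m) x) (G.d1 φ i x) + (∑ j, pair (G.piMom m j x) (G.d2 φ i j x))
        + (∑ k, pair (G.div2 m.p2 k x) (G.d2 φ k i x))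
        + (∑ k, ∑ j, pair (m.p2 k j x) (G.d3 φ k i j x))
        - ∑ k, ∑ j, ∑ l, G.kronD x l k j * pair (m.p2 k j x) (G.d2 φ l i x) := by
  have hd1 := hG.contDiffOn_d1 hφ
  have hd2 := hG.contDiffOn_d2 hφ
  have hπ := hG.contDiffOn_piMom hm
  have s1 : ∀ i j, DifferentiableAt ℝ (fun y => pair (G.piMom m j y) (G.d1 φ i y)) x := fun i j =>
    (contDiffOn_pair (hπ j) (hd1 i)).differentiableAt_of_isOpen hx hG.isOpen
  have s2 : ∀ k i j, DifferentiableAt ℝ (fun y => pair (m.p2 k j y) (G.d2 φ k i y)) x :=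
    fun k i j =>
      (contDiffOn_pair (hm.p2 k j) (hd2 k i)).differentiableAt_of_isOpen hx hG.isOpen
  have h0 : G.div11 (G.canon φ m) x i
      = G.div11 (fun y i j => pair (G.piMom m j y) (G.d1 φ i y)) x i
        + ∑ k, G.div11 (fun y i j => pair (m.p2 k j y) (G.d2 φ k i y)) x i := by
    rw [← G.div11_sum s2, ← G.div11_add s1 fun i j => DifferentiableAt.fun_sum fun k _ => s2 k i j]
    rfl
  have h1 := G.div11_pair (fun i => (hπ i).differentiableAt_of_isOpen hx hG.isOpen)
    (fun i => (hd1 i).differentiableAt_of_isOpen hx hG.isOpen) i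
  have h2 := fun k => G.div11_pair (fun i => (hm.p2 k i).differentiableAt_of_isOpen hx hG.isOpen)
    (fun i => (hd2 k i).differentiableAt_of_isOpen hx hG.isOpen) i
  have hd : ∀ k j, G.d1 (G.d2 φ k i) j x + ∑ l, G.P x l i j • G.d2 φ k l x
      = G.d3 φ k i j x - ∑ l, G.P x l k j • G.d2 φ l i x :=
    fun k j => by rw [d3_eq]; abel
  rw [h0, h1]
  simp only [h2, hd, ← d2_eq, div1_eq_div2 G m.p2, pair_sub_left,
    pair_sub_right, pair_sum_left, pair_sum_right, pair_smul_left, pair_smul_right,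
    Finset.sum_add_distrib, Finset.sum_sub_distrib]
  have e1 := sum_swap_outer fun l k r => G.Γ x l r k * pair (m.p2 r k x) (G.d2 φ l i x)
  simp only [kronD_eq, add_mul, Finset.sum_add_distrib]
  rw [e1]
  ring

/-- The divergency of the canonical part has `∂_k` acting before the last derivative; the
commutators in W restore the order required by `fieldChange`. The Kronecker term of W compensates
that of `div11_canon`, and its curvature and torsion terms compensate the divergency of the
superpotential part. -/
theorem aFPart_add_WPart_add_covDiv_thetaPart :
    G.aFPart φ m x + G.WPart φ m x + G.covDiv (G.thetaPart φ m) x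
      = ten01 (G.fieldChange φ m x) := by
  have hs := hG.contDiffOn_superpot hφ hm
  have hcan : DifferentiableAt ℝ (fun y => ten11 (G.canon φ m y)) x :=
    ContDiffOn.differentiableAt_of_isOpen hx
      (contDiffOn_ten.2 fun A B => hG.contDiffOn_canon hφ hm (B 0) (A 0)) hG.isOpen
  have htor : DifferentiableAt ℝ (fun y => ten11 (G.torsK φ m y)) x :=
    ContDiffOn.differentiableAt_of_isOpen hx
      (contDiffOn_ten.2 fun A B => hG.contDiffOn_torsK hφ hm (B 0) (A 0)) hG.isOpen
  have hsup : DifferentiableAt ℝ (G.covDiv fun y => ten21 (G.superpot φ m y)) x :=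
    ContDiffOn.differentiableAt_of_isOpen hx
      (hG.contDiffOn_covDiv (contDiffOn_ten.2 fun A B => hs (B 0) (A 0) (A 1))) hG.isOpen
  -- K plus the divergency of W, grouped so that `div11_superpot` gives its divergency at once.
  let Y : E n → Fin n → Fin n → ℝ := fun y k j =>
    (∑ r, ∑ l, G.torsion y r l j * G.superpot φ m y k r l) / 2 + G.div21 (G.superpot φ m) y k j
  have hθ : G.thetaPart φ m = (fun y => ten11 (G.canon φ m y)) - fun y => ten11 (Y y) := by
    ext y A B
    have := G.covDiv_ten21 (G.superpot φ m) y A B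
    simp only [thetaPart, Pi.sub_apply, this, ten11, torsK, Y, div21]
    ring
  have hY : DifferentiableAt ℝ (fun y => ten11 (Y y)) x := by
    have : (fun y => ten11 (Y y)) = (fun y => ten11 (G.torsK φ m y))
        + G.covDiv fun y => ten21 (G.superpot φ m y) := by
      ext y A B
      have := G.covDiv_ten21 (G.superpot φ m) y A B
      simp only [Pi.add_apply, this, ten11, torsK, Y, div21]
    rw [this]
    exact htor.add hsup
  have hdivY := fun k => G.div11_superpot hG hs
    (fun y k j l => by simp only [superpot]; ring) hx k
  ext A B
  have hc := G.covDiv_ten11 (G.canon φ m) x A B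
  have hy := G.covDiv_ten11 Y x A B
  have h1 := hG.div11_canon hx hφ hm (B 0)
  have h2 := hdivY (B 0)
  rw [hθ, G.covDiv_sub hcan hY]
  simp only [Pi.add_apply, Pi.sub_apply, hc, hy, aFPart, WPart, ten01, fieldChange,
    hG.eulerLagrange_eq hx hm, pair_sub_right, pair_sub_left, Finset.sum_sub_distrib]
  simp only [piMom, pair_sub_left, Finset.sum_sub_distrib, div11] at h1 h2 ⊢
  linear_combination h1 - h2

end Regular
end Geo

/-! ### Infinitesimal invariance of the Lagrangian -/

/-- The curve is t ↦ exp(ta), with inverse exp(-ta). -/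
theorem exists_GL_curve (a : Matrix (Fin n) (Fin n) ℝ) : ∃ c : ℝ → GL (Fin n) ℝ, c 0 = 1 ∧
    (∀ i j, HasDerivAt (fun t => (c t : Matrix (Fin n) (Fin n) ℝ) i j) (a i j) 0) ∧
    ∀ i j, HasDerivAt (fun t => ((c t)⁻¹ : GL (Fin n) ℝ).1 i j) ((-a) i j) 0 := by
  open scoped Matrix.Norms.Operator in
  have hexp : ∀ (a : Matrix (Fin n) (Fin n) ℝ) (i j : Fin n),
      HasDerivAt (fun t : ℝ => NormedSpace.exp (t • a) i j) (a i j) 0 := by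
    intro a i j
    have h := hasDerivAt_exp_smul_const (𝕂 := ℝ) a 0
    rw [zero_smul, NormedSpace.exp_zero, one_mul] at h
    exact (LinearMap.toContinuousLinearMap
      (Matrix.entryLinearMap ℝ ℝ i j)).hasFDerivAt.comp_hasDerivAt 0 h
  have hco : ∀ t : ℝ, ((Matrix.isUnit_exp (t • a)).unit⁻¹ : GL (Fin n) ℝ).1
      = NormedSpace.exp (t • (-a)) := by
    intro t
    rw [smul_neg, Matrix.exp_neg, Matrix.coe_units_inv]; rfl
  refine ⟨fun t => (Matrix.isUnit_exp (t • a)).unit, ?_, fun i j => hexp a i j, fun i j => ?_⟩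
  · ext i j; simp
  · simp only [hco]; exact hexp (-a) i j

/-- Differentiating a product of matrix entries at the identity leaves Kronecker deltas in all slots
but one; they select the multi-indices obtained from `C` by changing that slot. -/
theorem sum_filter_eq_off {r : ℕ} (C : Fin r → Fin n) (s : Fin r) (g : (Fin r → Fin n) → ℝ) :
    ∑ C', (if ∀ j ∈ Finset.univ.erase s, C j = C' j then g C' else 0)
      = ∑ l, g (update C s l) := by
  rw [← Finset.sum_filter]
  refine Finset.sum_nbij' (fun C' => C' s) (fun l => update C s l) (by simp) ?_ ?_ (by simp) ?_
  · intro l _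
    simp only [Finset.mem_filter, Finset.mem_univ, true_and, Finset.mem_erase, and_true]
    intro j hj
    rw [update_of_ne hj]
  all_goals
    intro C' hC'
    simp only [Finset.mem_filter, Finset.mem_univ, true_and, Finset.mem_erase, and_true] at hC'
    have : update C s (C' s) = C' := by
      ext j
      by_cases hj : j = s
      · subst hj; simp
      · rw [update_of_ne hj, hC' j hj]
    simp [this]

theorem sum_prod_one_mul {r : ℕ} (C : Fin r → Fin n) (g : (Fin r → Fin n) → ℝ) :
    ∑ C', (∏ s, (1 : Matrix (Fin n) (Fin n) ℝ) (C s) (C' s)) * g C' = g C := by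
  have : ∀ C' : Fin r → Fin n, (∏ s, (1 : Matrix (Fin n) (Fin n) ℝ) (C s) (C' s))
      = if C = C' then 1 else 0 := by
    intro C'
    simp only [Matrix.one_apply, Finset.prod_boole, funext_iff, Finset.mem_univ, true_implies]
  simp [this]

/-- Leibniz rule at the identity. Here `κ` may depend on `t`, so that the lemma can be applied to
the lower indices and then, with the result as `κ`, to the upper ones. -/
theorem hasDerivAt_sum_prod {r : ℕ} {c : ℝ → Matrix (Fin n) (Fin n) ℝ}
    {a : Matrix (Fin n) (Fin n) ℝ} (h0 : c 0 = 1)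
    (hc : ∀ i j, HasDerivAt (fun t => c t i j) (a i j) 0)
    {κ : ℝ → (Fin r → Fin n) → ℝ} {κ' : (Fin r → Fin n) → ℝ}
    (hκ : ∀ C, HasDerivAt (fun t => κ t C) (κ' C) 0) (C : Fin r → Fin n) :
    HasDerivAt (fun t => ∑ C', (∏ s, c t (C s) (C' s)) * κ t C') (slotAct a (κ 0) C + κ' C) 0 := by
  have h : HasDerivAt (fun t => ∑ C', (∏ s, c t (C s) (C' s)) * κ t C')
      (∑ C', ((∑ s, (∏ j ∈ Finset.univ.erase s, c 0 (C j) (C' j)) • a (C s) (C' s)) * κ 0 C'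
        + (∏ s, c 0 (C s) (C' s)) * κ' C')) 0 :=
    HasDerivAt.fun_sum fun C' _ =>
      (HasDerivAt.fun_finsetProd fun s _ => hc (C s) (C' s)).mul (hκ C')
  convert h using 1
  rw [h0, Finset.sum_add_distrib, sum_prod_one_mul]
  congr 1
  simp only [Matrix.one_apply, Finset.prod_boole, smul_eq_mul, Finset.sum_mul, slotAct]
  rw [eq_comm, Finset.sum_comm]
  refine Finset.sum_congr rfl fun s _ => ?_
  have := sum_filter_eq_off C s fun C' => a (C s) (C' s) * κ 0 C'
  simp only [update_self] at this
  rw [← this]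
  refine Finset.sum_congr rfl fun C' _ => ?_
  simp only [ite_mul, one_mul, zero_mul]

theorem act_eq (A Bi : Matrix (Fin n) (Fin n) ℝ) (K : Ten n p q) (C : Fin p → Fin n)
    (D : Fin q → Fin n) :
    act A Bi K C D = ∑ C', (∏ s, A (C s) (C' s)) *
      ∑ D', (∏ t, Bi.transpose (D t) (D' t)) * K C' D' := by
  simp only [act, Finset.mul_sum, mul_assoc, Matrix.transpose_apply]

theorem act_one (K : Ten n p q) : act 1 1 K = K := by
  ext C D
  rw [act_eq, Matrix.transpose_one, sum_prod_one_mul, sum_prod_one_mul]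

theorem hasDerivAt_act {c d : ℝ → Matrix (Fin n) (Fin n) ℝ} {a b : Matrix (Fin n) (Fin n) ℝ}
    (hc0 : c 0 = 1) (hd0 : d 0 = 1) (hc : ∀ i j, HasDerivAt (fun t => c t i j) (a i j) 0)
    (hd : ∀ i j, HasDerivAt (fun t => d t i j) ((-b) i j) 0) (K : Ten n p q) :
    HasDerivAt (fun t => act (c t) (d t) K) (infAct a b K) 0 := by
  refine hasDerivAt_pi.2 fun C => hasDerivAt_pi.2 fun D => ?_
  simp only [act_eq]
  have h1 : ∀ C' : Fin p → Fin n, HasDerivAt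
      (fun t => ∑ D', (∏ s, (d t).transpose (D s) (D' s)) * K C' D')
      (slotAct (-b).transpose (K C') D + 0) 0 := fun C' =>
    hasDerivAt_sum_prod (c := fun t => (d t).transpose) (a := (-b).transpose) (κ := fun _ => K C')
      (κ' := 0) (by simp [hd0]) (fun i j => hd j i) (fun D' => hasDerivAt_const _ _) D
  refine (hasDerivAt_sum_prod hc0 hc h1 C).congr_deriv ?_
  simp only [hd0, Matrix.transpose_one, sum_prod_one_mul, infAct, add_zero, sub_eq_add_neg]
  congr 1
  simp [slotAct]

/-- The infinitesimal change of the arguments of a Lagrangian invariant. -/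
def Jet.infAct (a b : Matrix (Fin n) (Fin n) ℝ) (z : Jet n p q) : Jet n p q :=
  (fun i j => (b * Matrix.of z.1 - Matrix.of z.1 * a) i j,
    LbarGeometry.infAct a b z.2.1, LbarGeometry.infAct a b z.2.2.1,
    LbarGeometry.infAct a b z.2.2.2.1, LbarGeometry.infAct a b z.2.2.2.2.1,
    LbarGeometry.infAct a b z.2.2.2.2.2.1, LbarGeometry.infAct a b z.2.2.2.2.2.2)

theorem Jet.act_one (z : Jet n p q) : Jet.act 1 1 z = z := by
  simp [Jet.act, LbarGeometry.act_one]

/-- `L` is constant along the orbit of `z` under two independent curves in GL(n) with velocities `a`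
and `b` at the identity; the chain rule at t = 0 gives the claim. -/
theorem Lagrangian.fderiv_infAct (L : Lagrangian n p q) {z : Jet n p q} (hz : z ∈ L.dom)
    (a b : Matrix (Fin n) (Fin n) ℝ) : fderiv ℝ L.toFun z (Jet.infAct a b z) = 0 := by
  obtain ⟨A, hA0, hA, hAi⟩ := exists_GL_curve a
  obtain ⟨B, hB0, hB, hBi⟩ := exists_GL_curve b
  have hA1 : (A 0 : Matrix (Fin n) (Fin n) ℝ) = 1 := by rw [hA0]; rfl
  have hB1 : (B 0 : Matrix (Fin n) (Fin n) ℝ) = 1 := by rw [hB0]; rfl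
  have hAi1 : (((A 0)⁻¹ : GL (Fin n) ℝ) : Matrix (Fin n) (Fin n) ℝ) = 1 := by
    rw [hA0, inv_one]; rfl
  have hBi1 : (((B 0)⁻¹ : GL (Fin n) ℝ) : Matrix (Fin n) (Fin n) ℝ) = 1 := by
    rw [hB0, inv_one]; rfl
  have hf : HasDerivAt (fun t => fun i j => ((B t : Matrix (Fin n) (Fin n) ℝ) * Matrix.of z.1
      * ((A t)⁻¹ : GL (Fin n) ℝ).1) i j)
      (fun i j => (b * Matrix.of z.1 - Matrix.of z.1 * a) i j) 0 := by
    refine hasDerivAt_pi.2 fun i => hasDerivAt_pi.2 fun j => ?_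
    have := HasDerivAt.fun_sum (u := Finset.univ) fun l (_ : l ∈ Finset.univ) =>
      (HasDerivAt.fun_sum (u := Finset.univ) fun r (_ : r ∈ Finset.univ) =>
        (hB i r).mul_const (Matrix.of z.1 r l)).mul (hAi l j)
    convert this using 1
    · ext t
      simp [Matrix.mul_apply]
    · rw [hB1, hAi1]
      simp [Matrix.mul_apply, Finset.sum_add_distrib, Matrix.one_apply, sub_eq_add_neg]
  have hcurve : HasDerivAt (fun t => Jet.act (A t) (B t) z) (Jet.infAct a b z) 0 :=
    hf.prodMk ((hasDerivAt_act hA1 hBi1 hA hBi _).prodMk ((hasDerivAt_act hA1 hBi1 hA hBi _).prodMk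
      ((hasDerivAt_act hA1 hBi1 hA hBi _).prodMk ((hasDerivAt_act hA1 hBi1 hA hBi _).prodMk
      ((hasDerivAt_act hA1 hBi1 hA hBi _).prodMk (hasDerivAt_act hA1 hBi1 hA hBi _))))))
  have hL : HasFDerivAt L.toFun (fderiv ℝ L.toFun z) z :=
    ((L.smooth.contDiffAt (L.isOpen_dom.mem_nhds hz)).differentiableAt (by simp)).hasFDerivAt
  have h1 := hL.comp_hasDerivAt_of_eq 0 hcurve (by rw [hA0, hB0, Jet.act_one])
  have h2 : (L.toFun ∘ fun t => Jet.act (A t) (B t) z) = fun _ => L.toFun z :=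
    funext fun t => (L.invariant z hz (A t) (B t)).2
  rw [h2] at h1
  exact h1.unique (hasDerivAt_const _ _)

/-! ### Linear functions of components -/

theorem linear_eq_pair (ℓ : Ten n p q →ₗ[ℝ] ℝ) (K : Ten n p q) :
    ℓ K = pair (fun A B => ℓ (unitTen A B)) K := by
  have h : K = ∑ A, ∑ B, K A B • unitTen A B := by
    ext A B
    simp only [Finset.sum_apply, Pi.smul_apply, unitTen, smul_eq_mul]
    simp only [Pi.single_apply, apply_ite (f := fun g : (Fin q → Fin n) → ℝ => g B),
      Pi.zero_apply, mul_ite, mul_one, mul_zero]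
    simp
  conv_lhs => rw [h]
  simp only [map_sum, map_smul, smul_eq_mul, pair]
  exact Finset.sum_congr rfl fun A _ => Finset.sum_congr rfl fun B _ => mul_comm _ _

theorem pair_eq_sum_slice (m K : Ten n p (q + 1)) :
    pair m K = ∑ i, pair (slice i m) (slice i K) := by
  simp only [pair]
  rw [Finset.sum_comm (s := Finset.univ (α := Fin n))]
  refine Finset.sum_congr rfl fun A _ => ?_
  rw [← (Fin.snocEquiv fun _ => Fin n).sum_comp, Fintype.sum_prod_type]
  rfl

theorem linear_eq_sum_pair (ℓ : Ten n p (q + 1) →ₗ[ℝ] ℝ) (K : Ten n p (q + 1)) :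
    ℓ K = ∑ i, pair (fun A B => ℓ (unitTen A (Fin.snoc B i))) (slice i K) := by
  rw [linear_eq_pair, pair_eq_sum_slice]; rfl

theorem linear_eq_sum_sum_pair (ℓ : Ten n p (q + 2) →ₗ[ℝ] ℝ) (K : Ten n p (q + 2)) :
    ℓ K = ∑ i, ∑ j, pair (fun A B => ℓ (unitTen A (Fin.snoc (Fin.snoc B i) j)))
      (slice i (slice j K)) := by
  rw [linear_eq_pair, pair_eq_sum_slice, Finset.sum_comm]
  refine Finset.sum_congr rfl fun j _ => ?_
  rw [pair_eq_sum_slice]; rfl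

/-! ### The two consequences of invariance along the fields -/

variable {M : Type*} [TopologicalSpace M] [ChartedSpace (E n) M]

theorem fderiv_ten {K : E n → Ten n p q} {x : E n} (hK : DifferentiableAt ℝ K x) (k : Fin n) :
    fderiv ℝ K x (EuclideanSpace.single k 1) = pdT k K x := by
  ext A B
  have h1 := fderiv_apply hK A
  have h2 := fderiv_apply (differentiableAt_pi.1 hK A) B
  simp only [pdT, pd, h2, h1]
  rfl

theorem LbarSpace.regular (X : LbarSpace n M) {e : Chart n M}
    (he : e ∈ IsManifold.maximalAtlas (𝓡 n) ∞ M) : (X.geo e).Regular e.target where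
  isOpen := e.open_target
  smoothΓ := X.smoothΓ e he
  smoothP := X.smoothP e he
  smoothf := X.smoothf e he
  f_nondeg := X.f_nondeg e he
  f_parallel := X.f_parallel e he

namespace LagrangianSystem

variable (S : LagrangianSystem n M p q) {e : Chart n M}

/-- The contribution of the six field arguments to the derivative of the Lagrangian invariant. -/
theorem dL_eq (e : Chart n M) (y : E n) (g0 : Ten n 0 2) (g1 : Ten n 0 3) (g2 : Ten n 0 4)
    (v0 : Ten n p q) (v1 : Ten n p (q + 1)) (v2 : Ten n p (q + 2)) :
    S.dL e y (0, g0, g1, g2, v0, v1, v2)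
      = (pair ((S.momG e).p0 y) g0 + (∑ i, pair ((S.momG e).p1 i y) (slice i g1))
          + ∑ i, ∑ j, pair ((S.momG e).p2 i j y) (slice i (slice j g2)))
        + (pair ((S.momV e).p0 y) v0 + (∑ i, pair ((S.momV e).p1 i y) (slice i v1))
          + ∑ i, ∑ j, pair ((S.momV e).p2 i j y) (slice i (slice j v2))) := by
  let ℓ : Jet n p q →ₗ[ℝ] ℝ := (fderiv ℝ S.L.toFun (jetAt (S.space.geo e) (S.V e) y)).toLinearMap
  have hs : ((0, g0, g1, g2, v0, v1, v2) : Jet n p q)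
      = (0, g0, 0, 0, 0, 0, 0) + (0, 0, g1, 0, 0, 0, 0) + (0, 0, 0, g2, 0, 0, 0)
        + ((0, 0, 0, 0, v0, 0, 0) + (0, 0, 0, 0, 0, v1, 0) + (0, 0, 0, 0, 0, 0, v2)) := by
    simp
  have h0 : S.dL e y (0, g0, g1, g2, v0, v1, v2) = ℓ (0, g0, g1, g2, v0, v1, v2) := rfl
  rw [h0, hs, map_add, map_add, map_add, map_add, map_add]
  -- Inclusions of the single field arguments into the jet; the values of `ℓ` on their unit
  -- components are the entries of `momG` and `momV`.
  let i1 : Ten n 0 2 →ₗ[ℝ] Jet n p q := ⟨⟨fun K => (0, K, 0, 0, 0, 0, 0), by simp⟩, by simp⟩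
  let i2 : Ten n 0 3 →ₗ[ℝ] Jet n p q := ⟨⟨fun K => (0, 0, K, 0, 0, 0, 0), by simp⟩, by simp⟩
  let i3 : Ten n 0 4 →ₗ[ℝ] Jet n p q := ⟨⟨fun K => (0, 0, 0, K, 0, 0, 0), by simp⟩, by simp⟩
  let i4 : Ten n p q →ₗ[ℝ] Jet n p q := ⟨⟨fun K => (0, 0, 0, 0, K, 0, 0), by simp⟩, by simp⟩
  let i5 : Ten n p (q + 1) →ₗ[ℝ] Jet n p q :=
    ⟨⟨fun K => (0, 0, 0, 0, 0, K, 0), by simp⟩, by simp⟩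
  let i6 : Ten n p (q + 2) →ₗ[ℝ] Jet n p q :=
    ⟨⟨fun K => (0, 0, 0, 0, 0, 0, K), by simp⟩, by simp⟩
  exact congrArg₂ (· + ·) (congrArg₂ (· + ·) (congrArg₂ (· + ·)
      (linear_eq_pair (ℓ ∘ₗ i1) g0) (linear_eq_sum_pair (ℓ ∘ₗ i2) g1))
      (linear_eq_sum_sum_pair (ℓ ∘ₗ i3) g2))
    (congrArg₂ (· + ·) (congrArg₂ (· + ·)
      (linear_eq_pair (ℓ ∘ₗ i4) v0) (linear_eq_sum_pair (ℓ ∘ₗ i5) v1))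
      (linear_eq_sum_sum_pair (ℓ ∘ₗ i6) v2))

variable (he : e ∈ IsManifold.maximalAtlas (𝓡 n) ∞ M)
include he

theorem contDiffOn_jetAt : ContDiffOn ℝ ∞ (jetAt (S.space.geo e) (S.V e)) e.target := by
  have hG := S.space.regular he
  have hg := S.space.metric.smooth e he
  have hV := S.tensorV.smooth e he
  have hg1 := hG.contDiffOn_covD hg
  have hV1 := hG.contDiffOn_covD hV
  exact hG.smoothf.prodMk (hg.prodMk (hg1.prodMk ((hG.contDiffOn_covD hg1).prodMk
    (hV.prodMk (hV1.prodMk (hG.contDiffOn_covD hV1))))))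

theorem contDiffOn_dL (z : Jet n p q) : ContDiffOn ℝ ∞ (fun y => S.dL e y z) e.target :=
  ((S.L.smooth.fderiv_of_isOpen S.L.isOpen_dom (m := ∞) (by simp)).comp (S.contDiffOn_jetAt he)
    fun y hy => S.admissible e he y hy).clm_apply contDiffOn_const

theorem contDiffOn_Lval : ContDiffOn ℝ ∞ (S.Lval e) e.target :=
  S.L.smooth.comp (S.contDiffOn_jetAt he) fun y hy => S.admissible e he y hy

theorem smooth_momG : (S.momG e).Smooth e.target where
  p0 := contDiffOn_ten.2 fun _ _ => S.contDiffOn_dL he _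
  p1 _ := contDiffOn_ten.2 fun _ _ => S.contDiffOn_dL he _
  p2 _ _ := contDiffOn_ten.2 fun _ _ => S.contDiffOn_dL he _

theorem smooth_momV : (S.momV e).Smooth e.target where
  p0 := contDiffOn_ten.2 fun _ _ => S.contDiffOn_dL he _
  p1 _ := contDiffOn_ten.2 fun _ _ => S.contDiffOn_dL he _
  p2 _ _ := contDiffOn_ten.2 fun _ _ => S.contDiffOn_dL he _

variable {y : E n} (hy : y ∈ e.target)
include hy

theorem dL_infAct (a b : Matrix (Fin n) (Fin n) ℝ) :
    S.dL e y (Jet.infAct a b (jetAt (S.space.geo e) (S.V e) y)) = 0 :=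
  S.L.fderiv_infAct (S.admissible e he y hy) a b

-- In `gen` only the indices of φ are moved, while `infAct` on φ_{;k} and φ_{;l;k} also moves the
-- derivative indices; `slice_infAct` produces the subtracted terms of `genChange`.
omit he hy in
theorem _root_.LbarGeometry.Geo.change_eq_genChange (G : Geo n) (φ : E n → Ten n p q)
    (m : Mom n p q) (y : E n) (i j : Fin n) :
    pair (m.p0 y) (infAct (G.conj y (Matrix.single i j 1)) (Matrix.single i j 1) (φ y))
      + (∑ k, pair (m.p1 k y) (slice k
          (infAct (G.conj y (Matrix.single i j 1)) (Matrix.single i j 1) (G.covD φ y))))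
      + ∑ l, ∑ k, pair (m.p2 l k y) (slice l (slice k
          (infAct (G.conj y (Matrix.single i j 1)) (Matrix.single i j 1)
            (G.covD (G.covD φ) y))))
      = G.genChange φ m y i j := by
  have h1 : ∀ k, slice k (infAct (G.conj y (Matrix.single i j 1)) (Matrix.single i j 1)
      (G.covD φ y)) = G.gen y i j (G.d1 φ k y) - if k = j then G.d1 φ i y else 0 := by
    intro k
    rw [slice_infAct, ← Geo.gen_eq]
    simp only [Matrix.single_apply, ite_and, ite_smul, one_smul, zero_smul]
    simp [Geo.d1, eq_comm]
  have h2 : ∀ l k, slice l (slice k (infAct (G.conj y (Matrix.single i j 1))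
      (Matrix.single i j 1) (G.covD (G.covD φ) y)))
      = G.gen y i j (G.d2 φ l k y) - (if l = j then G.d2 φ i k y else 0)
        - if k = j then G.d2 φ l i y else 0 := by
    intro l k
    have hs : ∀ (l : Fin n) (K K' : Ten n p (q + 1)), slice l (K - K') = slice l K - slice l K' :=
      fun _ _ _ => rfl
    rw [slice_infAct, hs, slice_infAct, ← Geo.gen_eq]
    simp only [Matrix.single_apply, ite_and, ite_smul, one_smul, zero_smul]
    have hz : ∀ l : Fin n, slice l (0 : Ten n p (q + 1)) = 0 := fun _ => rfl
    simp only [Finset.sum_ite_eq, Finset.mem_univ, if_true, apply_ite (slice l), hz, Geo.d2,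
      eq_comm (a := j)]
  simp only [h1, h2]
  simp only [← Geo.gen_eq, pair_sub_right, Geo.genChange,
    Finset.sum_sub_distrib]
  have hp : ∀ (m K : Ten n p q) (c : Prop) [Decidable c],
      pair m (if c then K else 0) = if c then pair m K else 0 := by
    intro m K c _
    split_ifs
    · rfl
    · exact map_zero (pairL m)
  have e1 : ∑ l, ∑ k, (if l = j then pair (m.p2 l k y) (G.d2 φ i k y) else 0)
      = ∑ k, pair (m.p2 j k y) (G.d2 φ i k y) := by
    rw [Finset.sum_comm]; simp
  simp only [hp, e1]
  simp only [Finset.sum_ite_eq', Finset.mem_univ, if_true]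
  ring

/-- The pair (f⁻¹ e f, e) changes `f` by e f - f f⁻¹ e f = 0, so infinitesimal invariance involves
the fields alone. -/
theorem genChange_add_genChange (i j : Fin n) :
    (S.space.geo e).genChange (S.V e) (S.momV e) y i j
      + (S.space.geo e).genChange (S.space.geo e).g (S.momG e) y i j = 0 := by
  set G := S.space.geo e with hGdef
  have h := S.dL_infAct he hy (G.conj y (Matrix.single i j 1)) (Matrix.single i j 1)
  have hf : (fun a b => (Matrix.single i j (1 : ℝ) * Matrix.of (G.f y)
      - Matrix.of (G.f y) * G.conj y (Matrix.single i j 1) : Matrix (Fin n) (Fin n) ℝ) a b)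
      = 0 := by
    have : Matrix.of (G.f y) * G.conj y (Matrix.single i j 1)
        = Matrix.single i j 1 * Matrix.of (G.f y) := by
      rw [Geo.conj, ← mul_assoc, ← mul_assoc,
        Matrix.mul_nonsing_inv _ (S.space.f_nondeg e he y hy), one_mul]
    rw [this, sub_self]; rfl
  rw [Jet.infAct] at h
  simp only [jetAt] at h
  rw [← hGdef, hf, dL_eq, G.change_eq_genChange, G.change_eq_genChange] at h
  linear_combination h

/-- ∂_k of the jet consists of the covariant derivatives of the field arguments plus an
infinitesimal change of bases, and `L` does not feel the latter. -/
theorem pd_Lval (k : Fin n) :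
    pd k (S.Lval e) y = (S.space.geo e).fieldChange (S.V e) (S.momV e) y k
      + (S.space.geo e).fieldChange (S.space.geo e).g (S.momG e) y k := by
  set G := S.space.geo e with hGdef
  have hG : G.Regular e.target := S.space.regular he
  have hU := e.open_target
  have hg : ContDiffOn ℝ ∞ G.g e.target := S.space.metric.smooth e he
  have hV := S.tensorV.smooth e he
  have hg1 := hG.contDiffOn_covD hg
  have hV1 := hG.contDiffOn_covD hV
  have hg2 := hG.contDiffOn_covD hg1
  have hV2 := hG.contDiffOn_covD hV1
  have df := hG.smoothf.differentiableAt_of_isOpen hy hU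
  have dg := hg.differentiableAt_of_isOpen hy hU
  have dg1 := hg1.differentiableAt_of_isOpen hy hU
  have dg2 := hg2.differentiableAt_of_isOpen hy hU
  have dV := hV.differentiableAt_of_isOpen hy hU
  have dV1 := hV1.differentiableAt_of_isOpen hy hU
  have dV2 := hV2.differentiableAt_of_isOpen hy hU
  have dJ := (S.contDiffOn_jetAt he).differentiableAt_of_isOpen hy hU
  have hL : DifferentiableAt ℝ S.L.toFun (jetAt (S.space.geo e) (S.V e) y) :=
    (S.L.smooth.contDiffAt (S.L.isOpen_dom.mem_nhds (S.admissible e he y hy))).differentiableAt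
      (by simp)
  have h1 : pd k (S.Lval e) y = S.dL e y (fderiv ℝ (jetAt G (S.V e)) y
      (EuclideanSpace.single k 1)) := by
    have : S.Lval e = S.L.toFun ∘ jetAt (S.space.geo e) (S.V e) := rfl
    rw [pd, this, fderiv_comp _ hL dJ]; rfl
  have hfd : fderiv ℝ G.f y (EuclideanSpace.single k 1)
      = fun i j => (G.Pm k y * Matrix.of (G.f y) - Matrix.of (G.f y) * -(G.Γm k y)) i j := by
    ext i j
    have h2 := congrFun (congrFun (hG.pd_f hy k) i) j
    have h3 := fderiv_apply df i
    have h4 := fderiv_apply (differentiableAt_pi.1 df i) j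
    rw [mul_neg, sub_neg_eq_add, add_comm, ← h2, Matrix.of_apply, pd, h4, h3]
    rfl
  -- This pair changes `f` by P f + f Γ, which is `∂_k f` by parallelism, and changes each field by
  -- the difference of its partial and covariant derivatives.
  have hinf := S.dL_infAct he hy (-(G.Γm k y)) (G.Pm k y)
  have hJ : fderiv ℝ (jetAt G (S.V e)) y (EuclideanSpace.single k 1)
      = (0, G.d1 G.g k y, G.d1 (G.covD G.g) k y, G.d1 (G.covD (G.covD G.g)) k y,
          G.d1 (S.V e) k y, G.d1 (G.covD (S.V e)) k y, G.d1 (G.covD (G.covD (S.V e))) k y)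
        + Jet.infAct (-(G.Γm k y)) (G.Pm k y) (jetAt G (S.V e) y) := by
    have hd : ∀ {a b : ℕ} {K : E n → Ten n a b}, DifferentiableAt ℝ K y →
        fderiv ℝ K y (EuclideanSpace.single k 1)
          = G.d1 K k y + infAct (-(G.Γm k y)) (G.Pm k y) (K y) := by
      intro a b K hK
      have := infAct_neg_left (G.Γm k y) (-G.Pm k y) (K y)
      rw [neg_neg] at this
      rw [fderiv_ten hK, G.d1_eq, this]; abel
    have hjet : jetAt G (S.V e) = fun y => (G.f y, G.g y, G.covD G.g y, G.covD (G.covD G.g) y,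
      S.V e y, G.covD (S.V e) y, G.covD (G.covD (S.V e)) y) := rfl
    rw [hjet, df.fderiv_prodMk (by fun_prop), dg.fderiv_prodMk (by fun_prop),
      dg1.fderiv_prodMk (by fun_prop), dg2.fderiv_prodMk (by fun_prop),
      dV.fderiv_prodMk (by fun_prop), dV1.fderiv_prodMk dV2]
    simp only [ContinuousLinearMap.prod_apply, hd dg, hd dg1, hd dg2, hd dV, hd dV1, hd dV2, hfd]
    simp [Jet.infAct]
  have hadd : ∀ z z', S.dL e y (z + z') = S.dL e y z + S.dL e y z' := fun z z' => map_add _ z z'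
  rw [h1, hJ, hadd, hinf, add_zero, dL_eq]
  exact add_comm _ _

end LagrangianSystem

/-! ### The Noether identities of a Lagrangian system -/

theorem Geo.covDiv_smul_kronecker (G : Geo n) {c : E n → ℝ} {x : E n}
    (hc : DifferentiableAt ℝ c x) :
    G.covDiv (p := 0) (fun y => c y • kronecker n) x
      = ten01 (fun k => pd k c x) + c x • G.covDiv (p := 0) (fun _ => kronecker n) x := by
  have hd : ∀ j, G.d1 (fun y => c y • kronecker n) j x
      = pd j c x • kronecker n + c x • G.d1 (fun _ => kronecker n) j x := by
    intro j
    rw [G.d1_eq, G.d1_eq, pdT_smul hc (differentiableAt_const _), infAct_smul, smul_add]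
    abel
  ext A B
  simp only [Geo.covDiv_apply, hd, Pi.add_apply, Pi.smul_apply, Finset.sum_add_distrib,
    smul_eq_mul, Finset.mul_sum, ten01]
  congr 1
  simp [kronecker, ten11, Fin.snoc]

namespace LagrangianSystem

variable (S : LagrangianSystem n M p q) {e : Chart n M}
  (he : e ∈ IsManifold.maximalAtlas (𝓡 n) ∞ M)
include he

theorem contDiffOn_LKr : ContDiffOn ℝ ∞ (S.LKr e) e.target :=
  (S.contDiffOn_Lval he).smul contDiffOn_const

theorem contDiffOn_sT : ContDiffOn ℝ ∞ (S.sT e) e.target :=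
  (((S.space.regular he).contDiffOn_belinfantePart (S.tensorV.smooth e he)
    (S.smooth_momV he)).add ((S.space.regular he).contDiffOn_belinfantePart
      (S.space.metric.smooth e he) (S.smooth_momG he))).sub (S.contDiffOn_LKr he)

theorem contDiffOn_Q : ContDiffOn ℝ ∞ (S.Q e) e.target :=
  ((S.space.regular he).contDiffOn_QPart (S.tensorV.smooth e he) (S.smooth_momV he)).add
    ((S.space.regular he).contDiffOn_QPart (S.space.metric.smooth e he) (S.smooth_momG he))

omit he in
/-- First covariant Noether identity. -/
theorem F_add_div_θ : S.F + S.δ S.θ ≐ 0 := by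
  intro e he y hy
  have hG := S.space.regular he
  have hV := S.tensorV.smooth e he
  have hg := S.space.metric.smooth e he
  have hmV := S.smooth_momV he
  have hmG := S.smooth_momG he
  have dθV := (hG.contDiffOn_thetaPart hV hmV).differentiableAt_of_isOpen hy hG.isOpen
  have dθG := (hG.contDiffOn_thetaPart hg hmG).differentiableAt_of_isOpen hy hG.isOpen
  have dL := (S.contDiffOn_Lval he).differentiableAt_of_isOpen hy hG.isOpen
  have dLK := (S.contDiffOn_LKr he).differentiableAt_of_isOpen hy hG.isOpen
  have hv := hG.aFPart_add_WPart_add_covDiv_thetaPart hy hV hmV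
  have hm := hG.aFPart_add_WPart_add_covDiv_thetaPart hy hg hmG
  have hdiv : S.δ (a := 0) S.θ e y
      = (S.space.geo e).covDiv ((S.space.geo e).thetaPart (S.V e) (S.momV e)) y
        + (S.space.geo e).covDiv ((S.space.geo e).thetaPart (S.space.geo e).g (S.momG e)) y
        - (ten01 (fun k => pd k (S.Lval e) y)
          + S.Lval e y • (S.space.geo e).covDiv (p := 0) (fun _ => kronecker n) y) := by
    rw [← (S.space.geo e).covDiv_smul_kronecker dL, ← Geo.covDiv_add _ dθV dθG]
    exact Geo.covDiv_sub _ (dθV.add dθG) dLK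
  have hL : ten01 (fun k => pd k (S.Lval e) y)
      = ten01 ((S.space.geo e).fieldChange (S.V e) (S.momV e) y)
        + ten01 ((S.space.geo e).fieldChange (S.space.geo e).g (S.momG e) y) := by
    ext A B
    exact S.pd_Lval he hy (B 0)
  -- The term L δKr contained in `gW` cancels the one that the divergency of -L Kr contributes to
  -- δθ; the gradient of `L` cancels the two field changes.
  have hF : S.F e y = ((S.space.geo e).aFPart (S.V e) (S.momV e) y
        + (S.space.geo e).WPart (S.V e) (S.momV e) y)
      + ((S.space.geo e).aFPart (S.space.geo e).g (S.momG e) y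
        + ((S.space.geo e).WPart (S.space.geo e).g (S.momG e) y
          + S.Lval e y • (S.space.geo e).covDiv (p := 0) (fun _ => kronecker n) y)) := rfl
  change S.F e y + S.δ (a := 0) S.θ e y = 0
  rw [hF, hdiv, hL, ← hv, ← hm]
  abel

omit he in
/-- Second covariant Noether identity. -/
theorem θ_sub_sT : S.θ - S.sT ≐ S.Q := by
  intro e he y hy
  have hG := S.space.regular he
  have hv := hG.thetaPart_sub_belinfantePart hy (S.tensorV.smooth e he) (S.smooth_momV he)
  have hm := hG.thetaPart_sub_belinfantePart hy (S.space.metric.smooth e he) (S.smooth_momG he)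
  -- Only the sum over both fields vanishes: invariance does not hold for `V` and `g` separately.
  have h0 : ten11 ((S.space.geo e).genChange (S.V e) (S.momV e) y)
      + ten11 ((S.space.geo e).genChange (S.space.geo e).g (S.momG e) y) = 0 := by
    ext A B
    exact S.genChange_add_genChange he hy (B 0) (A 0)
  have h1 : (S.θ - S.sT) e y
      = ((S.space.geo e).thetaPart (S.V e) (S.momV e) y
          - (S.space.geo e).belinfantePart (S.V e) (S.momV e) y)
        + ((S.space.geo e).thetaPart (S.space.geo e).g (S.momG e) y
          - (S.space.geo e).belinfantePart (S.space.geo e).g (S.momG e) y) := by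
    simp only [θ, sT, Pi.sub_apply, Pi.add_apply]
    abel
  rw [h1, hv, hm]
  change _ = (S.space.geo e).QPart (S.V e) (S.momV e) y
    + (S.space.geo e).QPart (S.space.geo e).g (S.momG e) y
  rw [sub_add_sub_comm, h0, sub_zero]

omit he in
theorem δ_congr {a b : ℕ} {X Y : ChartField n M (a + 1) b} (h : X ≐ Y) : S.δ X ≐ S.δ Y :=
  fun e he _ hy => (S.space.geo e).covDiv_congr e.open_target (fun z hz => h e he z hz) hy

omit he in
theorem div_θ : S.δ (a := 0) S.θ ≐ S.δ S.sT + S.δ S.Q := by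
  intro e he y hy
  have h : S.θ ≐ S.sT + S.Q := fun e he z hz => by
    have := S.θ_sub_sT e he z hz
    change S.θ e z - S.sT e z = S.Q e z at this
    change S.θ e z = S.sT e z + S.Q e z
    rw [← this]; abel
  rw [S.δ_congr (a := 0) h e he y hy]
  exact (S.space.geo e).covDiv_add
    ((S.contDiffOn_sT he).differentiableAt_of_isOpen hy e.open_target)
    ((S.contDiffOn_Q he).differentiableAt_of_isOpen hy e.open_target)

omit he in
theorem aFPart_eq_zero {G : Geo n} {φ : E n → Ten n p q} {m : Mom n p q} {y : E n}
    (h : G.eulerLagrange m y = 0) : G.aFPart φ m y = 0 := by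
  ext A B
  simp only [Geo.aFPart, ten01, h, pair_zero_left]; rfl

omit he in
theorem QPart_eq_zero {G : Geo n} {φ : E n → Ten n p q} {m : Mom n p q} {y : E n}
    (h : G.eulerLagrange m y = 0) : G.QPart φ m y = 0 := by
  ext A B
  simp only [Geo.QPart, ten11, h, pair_zero_left]; rfl

end LagrangianSystem

end LbarGeometry

end

/-! ### Consequences of the two identities -/

theorem mainTheorem7 {n p q : ℕ} {M : Type*} [TopologicalSpace M] [ChartedSpace (E n) M]
    [IsManifold (𝓡 n) ∞ M] (S : LagrangianSystem n M p q) :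
    -- the covariant Noether identities in index-free form
    (S.F + S.δ S.θ ≐ 0) ∧
    (S.θ - S.sT ≐ S.Q) ∧
    (S.raise1 S.F + S.raise1 (S.δ S.θ) ≐ 0) ∧
    (S.raise2 S.θ - S.raise2 S.sT ≐ S.raise2 S.Q) ∧
    -- relations between the covariant divergencies
    (S.δ (a := 0) S.θ ≐ S.δ S.sT + S.δ S.Q) ∧
    (S.δ (a := 0) S.sT ≐ S.δ S.θ - S.δ S.Q) ∧
    -- the case `δθ = 0`
    (S.Conserved S.θ → S.F ≐ 0 ∧ S.δ (a := 0) S.sT ≐ -S.δ S.Q) ∧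
    -- the case `δ(sT) = 0`, for `F ≠ 0` and for `F = 0`
    (S.Conserved S.sT → ¬ S.F ≐ 0 →
      S.δ (a := 0) S.θ ≐ S.δ S.Q ∧ S.δ (a := 0) S.Q ≐ -S.F) ∧
    (S.Conserved S.sT → S.F ≐ 0 → S.δ (a := 0) S.θ ≐ S.δ S.Q) ∧
    -- the case `δQ = 0`, for `F ≠ 0` and for `F = 0`
    (S.Conserved S.Q → ¬ S.F ≐ 0 →
      S.δ (a := 0) S.θ ≐ S.δ S.sT ∧ S.δ (a := 0) S.sT ≐ -S.F) ∧
    (S.Conserved S.Q → S.F ≐ 0 →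
      S.δ (a := 0) S.θ ≐ S.δ S.sT ∧ S.δ (a := 0) S.sT ≐ 0) ∧
    -- the case in which both Euler-Lagrange equations hold
    (S.ELv ≐ 0 → S.ELg ≐ 0 →
      (S.vaF ≐ 0 ∧ S.gaF ≐ 0 ∧ S.Q ≐ 0 ∧ S.vF ≐ S.vW ∧ S.gF ≐ S.gW ∧ S.aF ≐ 0) ∧
      (S.F ≐ S.W ∧ S.W + S.δ S.θ ≐ 0 ∧ S.θ ≐ S.sT ∧
        S.δ (a := 0) S.θ ≐ S.δ S.sT ∧ S.δ (a := 0) S.sT ≐ -S.W) ∧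
      (S.W ≐ 0 → S.Conserved S.θ ∧ S.Conserved S.sT)) := by
  have hF : ∀ e ∈ IsManifold.maximalAtlas (𝓡 n) ∞ M, ∀ y ∈ e.target,
      S.F e y + S.δ (a := 0) S.θ e y = 0 := S.F_add_div_θ
  have hQ : ∀ e ∈ IsManifold.maximalAtlas (𝓡 n) ∞ M, ∀ y ∈ e.target,
      S.θ e y - S.sT e y = S.Q e y := S.θ_sub_sT
  have hδ : ∀ e ∈ IsManifold.maximalAtlas (𝓡 n) ∞ M, ∀ y ∈ e.target,
      S.δ (a := 0) S.θ e y = S.δ (a := 0) S.sT e y + S.δ (a := 0) S.Q e y := S.div_θ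
  have hFneg : S.δ (a := 0) S.θ ≐ -S.F := fun e he y hy => by
    have := hF e he y hy
    exact (neg_eq_of_add_eq_zero_right this).symm
  refine ⟨S.F_add_div_θ, S.θ_sub_sT, ?_, ?_, S.div_θ, ?_, ?_, ?_, ?_, ?_, ?_, ?_⟩
  -- Raising an index is linear with coefficients independent of the field raised, so each identity
  -- carries over summand by summand.
  · intro e he y hy
    ext A B
    have h : ∀ k, S.F e y ![] ![k] + S.δ (a := 0) S.θ e y ![] ![k] = 0 := fun k =>
      congrFun (congrFun (hF e he y hy) ![]) ![k]
    change (∑ k, ∑ l, _ * S.F e y ![] ![k]) + (∑ k, ∑ l, _ * S.δ (a := 0) S.θ e y ![] ![k]) = 0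
    simp only [← Finset.sum_add_distrib, ← mul_add, h, mul_zero, Finset.sum_const_zero]
  · intro e he y hy
    ext A B
    have h : ∀ k, S.θ e y ![A 0] ![k] - S.sT e y ![A 0] ![k] = S.Q e y ![A 0] ![k] := fun k =>
      congrFun (congrFun (hQ e he y hy) ![A 0]) ![k]
    change (∑ k, ∑ l, S.θ e y ![A 0] ![k] * _ * _) - (∑ k, ∑ l, S.sT e y ![A 0] ![k] * _ * _)
      = ∑ k, ∑ l, S.Q e y ![A 0] ![k] * _ * _
    simp only [← Finset.sum_sub_distrib, ← sub_mul, h]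
  · intro e he y hy
    change _ = S.δ (a := 0) S.θ e y - S.δ (a := 0) S.Q e y
    rw [hδ e he y hy]; abel
  · intro h
    refine ⟨fun e he y hy => ?_, fun e he y hy => ?_⟩
    · have h1 := hF e he y hy
      rw [h e he y hy] at h1
      simpa using h1
    · have h1 := hδ e he y hy
      rw [h e he y hy] at h1
      exact eq_neg_of_add_eq_zero_left h1.symm
  · intro h _
    have h1 : S.δ (a := 0) S.θ ≐ S.δ S.Q := fun e he y hy => by
      rw [hδ e he y hy, h e he y hy]; exact zero_add _
    exact ⟨h1, fun e he y hy => by rw [← h1 e he y hy, hFneg e he y hy]⟩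
  · intro h _ e he y hy
    rw [hδ e he y hy, h e he y hy]; exact zero_add _
  · intro h _
    have h1 : S.δ (a := 0) S.θ ≐ S.δ S.sT := fun e he y hy => by
      rw [hδ e he y hy, h e he y hy]; exact add_zero _
    exact ⟨h1, fun e he y hy => by rw [← h1 e he y hy, hFneg e he y hy]⟩
  · intro h h0
    have h1 : S.δ (a := 0) S.θ ≐ S.δ S.sT := fun e he y hy => by
      rw [hδ e he y hy, h e he y hy]; exact add_zero _
    refine ⟨h1, fun e he y hy => ?_⟩
    rw [← h1 e he y hy, hFneg e he y hy]
    exact neg_eq_zero.2 (h0 e he y hy)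
  · intro hv hg
    have hva : S.vaF ≐ 0 := fun e he y hy =>
      LagrangianSystem.aFPart_eq_zero (hv e he y hy)
    have hga : S.gaF ≐ 0 := fun e he y hy =>
      LagrangianSystem.aFPart_eq_zero (hg e he y hy)
    have hQ0 : S.Q ≐ 0 := fun e he y hy =>
      (congrArg₂ (· + ·) (LagrangianSystem.QPart_eq_zero (hv e he y hy))
        (LagrangianSystem.QPart_eq_zero (hg e he y hy))).trans (add_zero _)
    have hvF : S.vF ≐ S.vW := fun e he y hy =>
      (congrArg (· + S.vW e y) (hva e he y hy)).trans (zero_add _)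
    have hgF : S.gF ≐ S.gW := fun e he y hy =>
      (congrArg (· + S.gW e y) (hga e he y hy)).trans (zero_add _)
    have haF : S.aF ≐ 0 := fun e he y hy =>
      (congrArg₂ (· + ·) (hva e he y hy) (hga e he y hy)).trans (add_zero _)
    have hFW : S.F ≐ S.W := fun e he y hy =>
      congrArg₂ (· + ·) (hvF e he y hy) (hgF e he y hy)
    have hθ : S.θ ≐ S.sT := fun e he y hy =>
      sub_eq_zero.1 ((hQ e he y hy).trans (hQ0 e he y hy))
    have hδθ : S.δ (a := 0) S.θ ≐ S.δ S.sT := S.δ_congr hθ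
    have hWθ : S.W + S.δ S.θ ≐ 0 := fun e he y hy => by
      change S.W e y + S.δ (a := 0) S.θ e y = 0
      rw [← hFW e he y hy]; exact hF e he y hy
    have hsT : S.δ (a := 0) S.sT ≐ -S.W := fun e he y hy => by
      change _ = - S.W e y
      rw [← hδθ e he y hy, hFneg e he y hy, ← hFW e he y hy]; rfl
    refine ⟨⟨hva, hga, hQ0, hvF, hgF, haF⟩, ⟨hFW, hWθ, hθ, hδθ, hsT⟩, fun hW => ?_⟩
    have hcons : S.Conserved S.sT := fun e he y hy =>
      (hsT e he y hy).trans (neg_eq_zero.2 (hW e he y hy))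
    exact ⟨fun e he y hy => (hδθ e he y hy).trans (hcons e he y hy), hcons⟩
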